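/- Let $k$ be an arbitrary field. For $f=(f_1,\dots,f_n)\in\operatorname{End}(\mathbb{A}^n_k)=k[x_1,\dots,x_n]^n$ put $\deg f=\max_i\deg f_i$, and for an automorphism $f$ let $\lambda(f)=\lim_{m\to\infty}\deg(f^m)^{1/m}$ be its dynamical degree, where $f^m$ is the $m$-th iterate. An automorphism of $\mathbb{A}^n_k$ is called affine-triangular if it is of the form $\alpha\circ\tau$ with $\alpha$ an affine automorphism (an automorphism of degree $1$) and $\tau=(\tau_1,\dots,\tau_n)$ a triangular endomorphism ($\tau_i\in k[x_1,\dots,x_i]$ for each $i$). For all integers $r,s,t\ge 1$, $$f=\bigl(y+x^rz^t,\; z,\; x+z^s(y+x^rz^t)\bigr)$$ is an automorphism of $\mathbb{A}^3_k$, the limit defining $\lambda(f)$ exists, $\lambda(f)$ is the largest real root of $x^2-(r+s+t)x+rs$, and $\lambda(f)>s+1$. Moreover, if $\lambda(f)$ is not an integer, then $\lambda(f)$ is not the dynamical degree of any affine-triangular automorphism of $\mathbb{A}^3_k$, and $f$ is not conjugate in $\operatorname{Aut}(\mathbb{A}^3_k)$ to any affine-triangular automorphism of $\mathbb{A}^3_k$.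 -/

import Mathlib

open Filter Topology MvPolynomial

/-- A polynomial endomorphism `(f₁, …, fₙ)` of affine `n`-space over `k`. -/
@[ext]
structure PolyEnd (k : Type*) [Field k] (n : ℕ) where
  coord : Fin n → MvPolynomial (Fin n) k

namespace PolyEnd

variable {k : Type*} [Field k] {n : ℕ}

/-- The monoid `End(𝔸ⁿ)`: the product is the composition of maps,
`(f * g)ᵢ = fᵢ(g₁, …, gₙ)`, and the unit is the identity `(x₁, …, xₙ)`.
Its units form the group `Aut(𝔸ⁿ)`. -/
noncomputable instance : Monoid (PolyEnd k n) where
  one := ⟨X⟩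
  mul f g := ⟨fun i => bind₁ g.coord (f.coord i)⟩
  mul_assoc f g h := by
    ext1
    funext i
    exact bind₁_bind₁ g.coord h.coord (f.coord i)
  one_mul f := by
    ext1
    funext i
    exact bind₁_X_right f.coord i
  mul_one f := by
    ext1
    funext i
    exact congrArg (fun φ => φ (f.coord i)) bind₁_X_left

/-- The degree of an endomorphism: the maximum of the degrees of its coordinates. -/
noncomputable def degree (f : PolyEnd k n) : ℕ :=
  Finset.univ.sup fun i => (f.coord i).totalDegree

/-- The sequence `m ↦ deg(f ^ m) ^ (1 / m)`, where `f ^ m` is the `m`-th iterate of `f`. -/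
noncomputable def degreeSeq (f : PolyEnd k n) (m : ℕ) : ℝ :=
  ((f ^ m).degree : ℝ) ^ (1 / (m : ℝ))

/-- The dynamical degree `λ(f) = lim deg(f ^ m) ^ (1 / m)`. -/
noncomputable def dynamicalDegree (f : PolyEnd k n) : ℝ :=
  limUnder atTop f.degreeSeq

/-- `f` is triangular: `fᵢ ∈ k[x₁, …, xᵢ]` for every `i`. -/
def IsTriangular (f : PolyEnd k n) : Prop :=
  ∀ i, f.coord i ∈ supported k (Set.Iic i)

/-- `f` is an affine automorphism: an automorphism of degree `1`. -/
def IsAffineAut (f : PolyEnd k n) : Prop :=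
  IsUnit f ∧ f.degree = 1

/-- `f` is affine-triangular: `f = α ∘ τ` with `α` an affine automorphism and `τ` a
triangular endomorphism. -/
def IsAffineTriangular (f : PolyEnd k n) : Prop :=
  ∃ α τ : PolyEnd k n, α.IsAffineAut ∧ τ.IsTriangular ∧ f = α * τ

/-- The endomorphism `(y + x^r z^t, z, x + z^s (y + x^r z^t))` of affine `3`-space,
where `x = X 0`, `y = X 1`, `z = X 2`. -/
noncomputable def rstMap (k : Type*) [Field k] (r s t : ℕ) : PolyEnd k 3 :=
  ⟨![X 1 + X 0 ^ r * X 2 ^ t, X 2, X 0 + X 2 ^ s * (X 1 + X 0 ^ r * X 2 ^ t)]⟩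

end PolyEnd

/-! Everything is read off from weights `μ i` on the variables. If all weights are positive and `f
i` has weight at most `θ * μ i`, then the iterates have weight at most `θ ^ m * μ i`, so λ(f) ≤ θ.
If moreover the parts of weight exactly `θ * μ i` form an endomorphism `G` whose iterates never
vanish in some coordinate of positive weight, then λ(f) ≥ θ (`dynamicalDegree_le_of_wtLE`,
`le_dynamicalDegree_of_hasLead`; the second bound needs no positivity of the other weights). For the
given map, the weights (θ - s, 1, θ) have a monomial leading part as soon as θ is the larger root of
the quadratic.

For an affine-triangular automorphism, a Bruhat decomposition of the linear part of α gives a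
conjugate that is a coordinate permutation composed with a triangular automorphism
(`IsAffineTriangular.exists_isConj_perm_mul`). For each of the six permutations the weight bounds
yield λ² = aλ + b with natural numbers a, b; the main tool is `isNatQuadratic_of_lead`.

The sign of the constant term separates the two families. If λ² = Bλ - rs and λ² = aλ + b, then (B -
a)λ = rs + b > 0, so λ is rational, and being an algebraic integer it is an integer
(`ne_of_sq_eq_nat_mul_add`). Conjugacy is excluded because λ is a conjugacy invariant. -/

namespace PolyEnd

variable {k : Type*} [Field k] {n : ℕ}

/-! ### Submultiplicativity of the degree and the dynamical degree -/

theorem mul_coord (f g : PolyEnd k n) (i : Fin n) :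
    (f * g).coord i = bind₁ g.coord (f.coord i) := rfl

theorem one_coord (i : Fin n) : (1 : PolyEnd k n).coord i = X i := rfl

theorem totalDegree_coord_le (f : PolyEnd k n) (i : Fin n) :
    (f.coord i).totalDegree ≤ f.degree :=
  Finset.le_sup (f := fun i => (f.coord i).totalDegree) (Finset.mem_univ i)

theorem totalDegree_bind₁_le (g : PolyEnd k n) (p : MvPolynomial (Fin n) k) :
    (bind₁ g.coord p).totalDegree ≤ p.totalDegree * g.degree := by
  conv_lhs => rw [p.as_sum]
  rw [map_sum]
  refine totalDegree_finsetSum_le fun m hm => ?_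
  rw [bind₁_monomial]
  refine (totalDegree_mul _ _).trans ?_
  rw [totalDegree_C, zero_add]
  refine (totalDegree_finsetProd _ _).trans ?_
  calc ∑ i ∈ m.support, (g.coord i ^ m i).totalDegree
      ≤ ∑ i ∈ m.support, m i * g.degree := by
        gcongr with i
        exact (totalDegree_pow _ _).trans (Nat.mul_le_mul_left _ (g.totalDegree_coord_le i))
    _ = (m.sum fun _ e => e) * g.degree := by rw [Finsupp.sum, Finset.sum_mul]
    _ ≤ _ := Nat.mul_le_mul_right _ (le_totalDegree hm)

theorem degree_mul_le (f g : PolyEnd k n) : (f * g).degree ≤ f.degree * g.degree :=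
  Finset.sup_le fun i _ => (totalDegree_bind₁_le g _).trans
    (Nat.mul_le_mul_right _ (f.totalDegree_coord_le i))

theorem one_le_degree_of_isUnit [NeZero n] {f : PolyEnd k n} (hf : IsUnit f) : 1 ≤ f.degree := by
  obtain ⟨g, hg⟩ := hf.exists_left_inv
  by_contra! h
  have h1 := degree_mul_le g f
  rw [hg, Nat.lt_one_iff.mp h, mul_zero] at h1
  have h2 := totalDegree_coord_le (1 : PolyEnd k n) 0
  rw [one_coord, totalDegree_X] at h2
  omega

theorem one_le_degree_pow [NeZero n] {f : PolyEnd k n} (hf : IsUnit f) (m : ℕ) :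
    (1 : ℝ) ≤ ((f ^ m).degree : ℝ) := by
  exact_mod_cast one_le_degree_of_isUnit (hf.pow m)

/-- Fekete's lemma for log deg(f^m): it is subadditive because degrees are submultiplicative, and
nonnegative because iterates of an automorphism have degree at least 1. -/
theorem tendsto_degreeSeq [NeZero n] {f : PolyEnd k n} (hf : IsUnit f) :
    Tendsto f.degreeSeq atTop (𝓝 f.dynamicalDegree) := by
  have hpos := one_le_degree_pow hf
  have hsub : Subadditive fun m => Real.log ((f ^ m).degree : ℝ) := by
    intro a b
    rw [← Real.log_mul (by linarith [hpos a]) (by linarith [hpos b])]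
    refine Real.log_le_log (by linarith [hpos (a + b)]) ?_
    rw [pow_add]
    exact_mod_cast degree_mul_le (f ^ a) (f ^ b)
  have hbdd : BddBelow (Set.range fun m : ℕ => Real.log ((f ^ m).degree : ℝ) / m) := by
    refine ⟨0, ?_⟩
    rintro _ ⟨m, rfl⟩
    exact div_nonneg (Real.log_nonneg (hpos m)) (Nat.cast_nonneg m)
  have h := (hsub.tendsto_lim hbdd).rexp
  have h2 : Tendsto f.degreeSeq atTop (𝓝 (Real.exp hsub.lim)) := by
    refine h.congr fun m => ?_
    rw [degreeSeq, Real.rpow_def_of_pos (by linarith [hpos m])]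
    ring_nf
  rw [dynamicalDegree, h2.limUnder_eq]
  exact h2

theorem tendsto_const_rpow_inv {C : ℝ} (hC : 0 < C) :
    Tendsto (fun m : ℕ => C ^ (1 / (m : ℝ))) atTop (𝓝 1) := by
  have h := tendsto_const_nhds (x := C) |>.rpow tendsto_one_div_atTop_nhds_zero_nat
    (Or.inl hC.ne')
  simpa using h

theorem tendsto_geometric_rpow_inv {C θ : ℝ} (hC : 0 < C) (hθ : 0 ≤ θ) :
    Tendsto (fun m : ℕ => (C * θ ^ m) ^ (1 / (m : ℝ))) atTop (𝓝 θ) := by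
  have h := (tendsto_const_rpow_inv hC).mul_const θ
  rw [one_mul] at h
  refine h.congr' ?_
  filter_upwards [eventually_ne_atTop 0] with m hm
  rw [Real.mul_rpow hC.le (by positivity), one_div, Real.pow_rpow_inv_natCast hθ hm]

theorem dynamicalDegree_le_of_degree_le [NeZero n] {f : PolyEnd k n} (hf : IsUnit f)
    {C θ : ℝ} (hC : 0 < C) (hθ : 0 ≤ θ) (h : ∀ m, ((f ^ m).degree : ℝ) ≤ C * θ ^ m) :
    f.dynamicalDegree ≤ θ :=
  le_of_tendsto_of_tendsto' (tendsto_degreeSeq hf) (tendsto_geometric_rpow_inv hC hθ)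
    fun m => Real.rpow_le_rpow (by positivity) (h m) (by positivity)

theorem le_dynamicalDegree_of_le_degree [NeZero n] {f : PolyEnd k n} (hf : IsUnit f)
    {C θ : ℝ} (hC : 0 < C) (hθ : 0 ≤ θ) (h : ∀ m, C * θ ^ m ≤ ((f ^ m).degree : ℝ)) :
    θ ≤ f.dynamicalDegree :=
  le_of_tendsto_of_tendsto' (tendsto_geometric_rpow_inv hC hθ) (tendsto_degreeSeq hf)
    fun m => Real.rpow_le_rpow (by positivity) (h m) (by positivity)

theorem one_le_dynamicalDegree [NeZero n] {f : PolyEnd k n} (hf : IsUnit f) :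
    1 ≤ f.dynamicalDegree :=
  le_dynamicalDegree_of_le_degree hf one_pos zero_le_one (by simpa using one_le_degree_pow hf)

theorem isUnit_of_isConj {f g : PolyEnd k n} (h : IsConj f g) (hf : IsUnit f) : IsUnit g := by
  obtain ⟨c, hc⟩ := h
  rw [← (Units.mul_inv_eq_iff_eq_mul c).mpr hc.eq]
  exact (c.isUnit.mul hf).mul c⁻¹.isUnit

/-- Conjugation by `c` changes deg(f^m) by at most the constant factor deg(c) deg(c⁻¹), whose m-th
root tends to 1. -/
theorem dynamicalDegree_le_of_isConj [NeZero n] {f g : PolyEnd k n} (h : IsConj f g)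
    (hf : IsUnit f) : g.dynamicalDegree ≤ f.dynamicalDegree := by
  have hg := isUnit_of_isConj h hf
  obtain ⟨c, hc⟩ := h
  have hC : (0 : ℝ) < ((c : PolyEnd k n).degree * (↑c⁻¹ : PolyEnd k n).degree : ℕ) := by
    exact_mod_cast Nat.mul_pos (one_le_degree_of_isUnit c.isUnit)
      (one_le_degree_of_isUnit c⁻¹.isUnit)
  have h1 := (tendsto_const_rpow_inv hC).mul (tendsto_degreeSeq hf)
  rw [one_mul] at h1
  refine le_of_tendsto_of_tendsto' (tendsto_degreeSeq hg) h1 fun m => ?_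
  rw [degreeSeq, degreeSeq, ← Real.mul_rpow hC.le (by positivity)]
  refine Real.rpow_le_rpow (by positivity) ?_ (by positivity)
  have h2 : g ^ m = c * f ^ m * ↑c⁻¹ :=
    ((Units.mul_inv_eq_iff_eq_mul c).mpr (hc.pow_right m).eq).symm
  have h3 : (g ^ m).degree ≤ (c : PolyEnd k n).degree * (f ^ m).degree *
      (↑c⁻¹ : PolyEnd k n).degree := by
    rw [h2]
    exact (degree_mul_le _ _).trans (Nat.mul_le_mul_right _ (degree_mul_le _ _))
  rw [mul_right_comm] at h3
  exact_mod_cast h3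

theorem dynamicalDegree_eq_of_isConj [NeZero n] {f g : PolyEnd k n} (h : IsConj f g)
    (hf : IsUnit f) : g.dynamicalDegree = f.dynamicalDegree :=
  le_antisymm (dynamicalDegree_le_of_isConj h hf)
    (dynamicalDegree_le_of_isConj h.symm (isUnit_of_isConj h hf))

end PolyEnd

/-! ### Real weights and leading parts -/

section Weights

variable {σ k : Type*} [Field k]

/-- Every monomial of `F` has `μ`-weight at most `W`. -/
def WtLE (μ : σ → ℝ) (F : MvPolynomial σ k) (W : ℝ) : Prop :=
  ∀ m ∈ F.support, Finsupp.weight μ m ≤ W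

/-- Every monomial of `F` has `μ`-weight less than `W`. -/
def WtLT (μ : σ → ℝ) (F : MvPolynomial σ k) (W : ℝ) : Prop :=
  ∀ m ∈ F.support, Finsupp.weight μ m < W

/-- `G` is the part of `μ`-weight `W` of `F`, and `F` has no monomial of larger weight. -/
def HasLead (μ : σ → ℝ) (F : MvPolynomial σ k) (W : ℝ) (G : MvPolynomial σ k) : Prop :=
  IsWeightedHomogeneous μ G W ∧ WtLT μ (F - G) W

variable {μ : σ → ℝ} {F F' G G' : MvPolynomial σ k} {W W' : ℝ}

theorem WtLE.wtLT (h : WtLE μ F W) (hW : W < W') : WtLT μ F W' :=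
  fun m hm => (h m hm).trans_lt hW

theorem WtLE.mono (h : WtLE μ F W) (hW : W ≤ W') : WtLE μ F W' :=
  fun m hm => (h m hm).trans hW

theorem WtLT.wtLE (h : WtLT μ F W) : WtLE μ F W := fun m hm => (h m hm).le

theorem wtLT_zero : WtLT μ (0 : MvPolynomial σ k) W := by
  intro m hm
  simp at hm

theorem WtLE.add (h : WtLE μ F W) (h' : WtLE μ F' W) : WtLE μ (F + F') W := by
  classical
  intro m hm
  rcases Finset.mem_union.mp (support_add hm) with hm | hm
  exacts [h m hm, h' m hm]

theorem WtLT.add (h : WtLT μ F W) (h' : WtLT μ F' W) : WtLT μ (F + F') W := by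
  classical
  intro m hm
  rcases Finset.mem_union.mp (support_add hm) with hm | hm
  exacts [h m hm, h' m hm]

theorem WtLT.sum {ι : Type*} (s : Finset ι) (f : ι → MvPolynomial σ k)
    (h : ∀ i ∈ s, WtLT μ (f i) W) : WtLT μ (∑ i ∈ s, f i) W :=
  Finset.sum_induction f (fun F => WtLT μ F W) (fun _ _ => WtLT.add) wtLT_zero h

theorem WtLE.mul (h : WtLE μ F W) (h' : WtLE μ F' W') : WtLE μ (F * F') (W + W') := by
  classical
  intro m hm
  obtain ⟨a, ha, b, hb, rfl⟩ := Finset.mem_add.mp (support_mul _ _ hm)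
  rw [map_add]
  exact add_le_add (h a ha) (h' b hb)

theorem WtLT.mul_wtLE (h : WtLT μ F W) (h' : WtLE μ F' W') : WtLT μ (F * F') (W + W') := by
  classical
  intro m hm
  obtain ⟨a, ha, b, hb, rfl⟩ := Finset.mem_add.mp (support_mul _ _ hm)
  rw [map_add]
  exact add_lt_add_of_lt_of_le (h a ha) (h' b hb)

theorem WtLE.mul_wtLT (h : WtLE μ F W) (h' : WtLT μ F' W') : WtLT μ (F * F') (W + W') := by
  rw [mul_comm, add_comm]
  exact h'.mul_wtLE h

theorem MvPolynomial.IsWeightedHomogeneous.wtLE (h : IsWeightedHomogeneous μ F W) :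
    WtLE μ F W := fun _ hm => (h (mem_support_iff.mp hm)).le

theorem wtLE_C (c : k) : WtLE μ (C c) 0 := (isWeightedHomogeneous_C μ c).wtLE

theorem wtLE_X (i : σ) : WtLE μ (X i : MvPolynomial σ k) (μ i) :=
  (isWeightedHomogeneous_X k μ i).wtLE

theorem wtLE_C_mul_X (c : k) (i : σ) : WtLE μ (C c * X i : MvPolynomial σ k) (μ i) := by
  simpa using (wtLE_C (μ := μ) c).mul (wtLE_X i)

theorem HasLead.wtLE (h : HasLead μ F W G) : WtLE μ F W := by
  have := h.2.wtLE.add h.1.wtLE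
  rwa [sub_add_cancel] at this

theorem MvPolynomial.IsWeightedHomogeneous.hasLead (h : IsWeightedHomogeneous μ F W) :
    HasLead μ F W F := ⟨h, by rw [sub_self]; exact wtLT_zero⟩

theorem WtLT.hasLead_zero (h : WtLT μ F W) : HasLead μ F W 0 :=
  ⟨isWeightedHomogeneous_zero k μ W, by rwa [sub_zero]⟩

theorem HasLead.add (h : HasLead μ F W G) (h' : HasLead μ F' W G') :
    HasLead μ (F + F') W (G + G') :=
  ⟨h.1.add h'.1, by rw [add_sub_add_comm]; exact h.2.add h'.2⟩

theorem HasLead.add_wtLT (h : HasLead μ F W G) (h' : WtLT μ F' W) :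
    HasLead μ (F + F') W G := by
  simpa using h.add h'.hasLead_zero

theorem HasLead.mul (h : HasLead μ F W G) (h' : HasLead μ F' W' G') :
    HasLead μ (F * F') (W + W') (G * G') := by
  refine ⟨h.1.mul h'.1, ?_⟩
  rw [show F * F' - G * G' = (F - G) * F' + G * (F' - G') by ring]
  exact (h.2.mul_wtLE h'.wtLE).add (h.1.wtLE.mul_wtLT h'.2)

theorem hasLead_C (c : k) : HasLead μ (C c) 0 (C c) := (isWeightedHomogeneous_C μ c).hasLead

theorem HasLead.C_mul (h : HasLead μ F W G) (c : k) : HasLead μ (C c * F) W (C c * G) := by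
  simpa using (hasLead_C (μ := μ) c).mul h

theorem hasLead_C_mul_X (c : k) (i : σ) : HasLead μ (C c * X i) (μ i) (C c * X i) :=
  (isWeightedHomogeneous_X k μ i).hasLead.C_mul c

theorem HasLead.pow (h : HasLead μ F W G) (e : ℕ) : HasLead μ (F ^ e) (e * W) (G ^ e) := by
  induction e with
  | zero => simpa using hasLead_C (μ := μ) (1 : k)
  | succ e ih =>
    rw [pow_succ, pow_succ, Nat.cast_succ, add_one_mul]
    exact ih.mul h

theorem HasLead.prod {ι : Type*} (s : Finset ι) (f g : ι → MvPolynomial σ k) (w : ι → ℝ)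
    (h : ∀ i ∈ s, HasLead μ (f i) (w i) (g i)) :
    HasLead μ (∏ i ∈ s, f i) (∑ i ∈ s, w i) (∏ i ∈ s, g i) := by
  classical
  induction s using Finset.induction_on with
  | empty => simpa using hasLead_C (μ := μ) (1 : k)
  | insert a s ha ih =>
    rw [Finset.prod_insert ha, Finset.prod_insert ha, Finset.sum_insert ha]
    exact (h a (Finset.mem_insert_self a s)).mul
      (ih fun i hi => h i (Finset.mem_insert_of_mem hi))

theorem HasLead.monomial_bind₁ {f g : σ → MvPolynomial σ k} {ρ : ℝ}
    (h : ∀ i, HasLead μ (f i) (ρ * μ i) (g i)) (m : σ →₀ ℕ) (c : k) :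
    HasLead μ (bind₁ f (monomial m c)) (ρ * Finsupp.weight μ m) (bind₁ g (monomial m c)) := by
  rw [bind₁_monomial, bind₁_monomial, Finsupp.weight_apply, Finsupp.sum, Finset.mul_sum]
  refine HasLead.C_mul (HasLead.prod _ _ _ _ fun i _ => ?_) c
  convert (h i).pow (m i) using 1
  simp only [nsmul_eq_mul]
  ring

/-- Substitution multiplies weights by `ρ`. Positivity of `ρ` keeps the lower monomials of `F`
strictly lower. The resulting leading part is allowed to be zero, so nonvanishing has to be proved
separately where it is needed. -/
theorem HasLead.bind₁ {f g : σ → MvPolynomial σ k} {ρ : ℝ} (hρ : 0 < ρ)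
    (h : ∀ i, HasLead μ (f i) (ρ * μ i) (g i)) (hF : HasLead μ F W G) :
    HasLead μ (MvPolynomial.bind₁ f F) (ρ * W) (MvPolynomial.bind₁ g G) := by
  have hom : ∀ m ∈ G.support, Finsupp.weight μ m = W := fun m hm =>
    hF.1 (mem_support_iff.mp hm)
  have h1 : HasLead μ (MvPolynomial.bind₁ f G) (ρ * W) (MvPolynomial.bind₁ g G) := by
    rw [G.as_sum, map_sum, map_sum]
    refine ⟨IsWeightedHomogeneous.sum _ _ _ fun m hm => ?_, ?_⟩
    · rw [← hom m hm]
      exact (HasLead.monomial_bind₁ h m _).1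
    · rw [← Finset.sum_sub_distrib]
      refine WtLT.sum _ _ fun m hm => ?_
      rw [← hom m hm]
      exact (HasLead.monomial_bind₁ h m _).2
  have h2 : WtLT μ (MvPolynomial.bind₁ f (F - G)) (ρ * W) := by
    rw [(F - G).as_sum, map_sum]
    exact WtLT.sum _ _ fun m hm => (HasLead.monomial_bind₁ h m _).wtLE.wtLT
      (mul_lt_mul_of_pos_left (hF.2 m hm) hρ)
  have := h1.add_wtLT h2
  rwa [← map_add, add_sub_cancel] at this

theorem WtLE.hasLead_component (h : WtLE μ F W) :
    HasLead μ F W (weightedHomogeneousComponent μ W F) := by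
  classical
  refine ⟨by apply weightedHomogeneousComponent_isWeightedHomogeneous, fun m hm => ?_⟩
  rw [mem_support_iff, coeff_sub, coeff_weightedHomogeneousComponent] at hm
  split_ifs at hm with hW
  · simp at hm
  · rw [sub_zero] at hm
    exact lt_of_le_of_ne (h m (mem_support_iff.mpr hm)) hW

theorem mem_support_component {m : σ →₀ ℕ} :
    m ∈ (weightedHomogeneousComponent μ W F).support ↔ m ∈ F.support ∧ Finsupp.weight μ m = W := by
  classical
  rw [mem_support_iff, coeff_weightedHomogeneousComponent, mem_support_iff]
  split_ifs with h <;> simp [h]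

end Weights

/-! ### Bounds on the dynamical degree from weights -/

namespace PolyEnd

variable {k : Type*} [Field k] {n : ℕ} {μ : Fin n → ℝ} {f G : PolyEnd k n} {θ : ℝ}

theorem hasLead_pow (hθ : 0 < θ) (h : ∀ i, HasLead μ (f.coord i) (θ * μ i) (G.coord i)) (m : ℕ)
    (i : Fin n) : HasLead μ ((f ^ m).coord i) (θ ^ m * μ i) ((G ^ m).coord i) := by
  induction m generalizing i with
  | zero =>
    simpa [one_coord] using (isWeightedHomogeneous_X k μ i).hasLead
  | succ m ih =>
    rw [pow_succ' f, pow_succ' G, mul_coord, mul_coord]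
    have := HasLead.bind₁ (pow_pos hθ m) ih (h i)
    rwa [← mul_assoc, ← pow_succ] at this

/-- The degree of a monomial is at most its weight divided by the least weight `μ a`, and the
weights of `f ^ m` are at most `θ ^ m * μ b` with `μ b` the largest. -/
theorem dynamicalDegree_le_of_wtLE [NeZero n] (hf : IsUnit f) (hθ : 0 < θ) (hμ : ∀ i, 0 < μ i)
    (h : ∀ i, WtLE μ (f.coord i) (θ * μ i)) : f.dynamicalDegree ≤ θ := by
  obtain ⟨a, -, ha⟩ := Finset.exists_min_image Finset.univ μ ⟨0, Finset.mem_univ _⟩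
  obtain ⟨b, -, hb⟩ := Finset.exists_max_image Finset.univ μ ⟨0, Finset.mem_univ _⟩
  refine dynamicalDegree_le_of_degree_le hf (C := μ b / μ a) (div_pos (hμ b) (hμ a)) hθ.le
    fun m => ?_
  have key : ∀ i, (((f ^ m).coord i).totalDegree : ℝ) ≤ μ b / μ a * θ ^ m := by
    intro i
    have hl := (hasLead_pow (G := ⟨fun i => weightedHomogeneousComponent μ (θ * μ i) (f.coord i)⟩)
      hθ (fun i => (h i).hasLead_component) m i).wtLE
    by_cases h0 : (f ^ m).coord i = 0
    · rw [h0, totalDegree_zero, Nat.cast_zero]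
      have := hμ a
      have := hμ b
      positivity
    obtain ⟨e, he, hd⟩ := Finset.exists_mem_eq_sup _ (support_nonempty.mpr h0)
      (fun s : Fin n →₀ ℕ => s.sum fun _ e => e)
    rw [totalDegree, hd, div_mul_eq_mul_div, le_div_iff₀ (hμ a)]
    calc ((e.sum fun _ e => e : ℕ) : ℝ) * μ a = ∑ j, (e j : ℝ) * μ a := by
          rw [Finsupp.sum_fintype _ _ (fun _ => rfl), Nat.cast_sum, Finset.sum_mul]
      _ ≤ ∑ j, (e j : ℝ) * μ j := by
          gcongr with j
          exact ha j (Finset.mem_univ _)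
      _ = Finsupp.weight μ e := by simp [Finsupp.weight_eq_sum]
      _ ≤ θ ^ m * μ i := hl e he
      _ ≤ θ ^ m * μ b := by
          gcongr
          exact hb i (Finset.mem_univ _)
      _ = _ := mul_comm _ _
  obtain ⟨i, -, hi⟩ := Finset.exists_mem_eq_sup Finset.univ ⟨0, Finset.mem_univ _⟩
    (fun i => ((f ^ m).coord i).totalDegree)
  rw [degree, hi]
  exact key i

theorem le_dynamicalDegree_of_hasLead [NeZero n] (hf : IsUnit f) (hθ : 0 < θ)
    (h : ∀ i, HasLead μ (f.coord i) (θ * μ i) (G.coord i)) {i : Fin n} (hi : 0 < μ i)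
    (hG : ∀ m, (G ^ m).coord i ≠ 0) : θ ≤ f.dynamicalDegree := by
  obtain ⟨b, -, hb⟩ := Finset.exists_max_image Finset.univ μ ⟨0, Finset.mem_univ _⟩
  have hb0 : 0 < μ b := hi.trans_le (hb i (Finset.mem_univ _))
  refine le_dynamicalDegree_of_le_degree hf (C := μ i / μ b) (div_pos hi hb0) hθ.le fun m => ?_
  have hl := hasLead_pow hθ h m i
  obtain ⟨e, he⟩ := support_nonempty.mpr (hG m)
  have hw := hl.1 (mem_support_iff.mp he)
  -- A monomial of `G ^ m` missing from `f ^ m` would survive in the difference, where only smaller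
  -- weights occur.
  have hef : e ∈ ((f ^ m).coord i).support := by
    by_contra hc
    refine (hl.2 e ?_).ne hw
    rw [mem_support_iff, coeff_sub, notMem_support_iff.mp hc, zero_sub, neg_ne_zero]
    exact mem_support_iff.mp he
  rw [div_mul_eq_mul_div, div_le_iff₀ hb0, mul_comm (μ i), ← hw]
  calc Finsupp.weight μ e = ∑ j, (e j : ℝ) * μ j := by simp [Finsupp.weight_eq_sum]
    _ ≤ ∑ j, (e j : ℝ) * μ b := by
        gcongr with j
        exact hb j (Finset.mem_univ _)
    _ = ((e.sum fun _ e => e : ℕ) : ℝ) * μ b := by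
        rw [Finsupp.sum_fintype _ _ (fun _ => rfl), Nat.cast_sum, Finset.sum_mul]
    _ ≤ _ := by
        gcongr
        exact (le_totalDegree hef).trans (totalDegree_coord_le _ _)

end PolyEnd

/-! ### Polynomials in a subset of the variables -/

section Supported

variable {σ k : Type*} [Field k] {s t : Set σ} {p : MvPolynomial σ k}

theorem algHom_eq_of_mem_supported {A : Type*} [CommSemiring A] [Algebra k A]
    {φ ψ : MvPolynomial σ k →ₐ[k] A} (hp : p ∈ supported k s)
    (h : ∀ i ∈ s, φ (X i) = ψ (X i)) : φ p = ψ p := by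
  have : Algebra.adjoin k (X '' s) ≤ AlgHom.equalizer φ ψ := by
    rw [Algebra.adjoin_le_iff]
    rintro _ ⟨i, hi, rfl⟩
    exact h i hi
  exact this hp

theorem algHom_mem_of_mem_supported {A : Type*} [CommSemiring A] [Algebra k A]
    {φ : MvPolynomial σ k →ₐ[k] A} {S : Subalgebra k A} (hp : p ∈ supported k s)
    (h : ∀ i ∈ s, φ (X i) ∈ S) : φ p ∈ S := by
  have : Algebra.adjoin k (X '' s) ≤ S.comap φ := by
    rw [Algebra.adjoin_le_iff]
    rintro _ ⟨i, hi, rfl⟩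
    exact h i hi
  exact this hp

theorem bind₁_mem_supported {v : σ → MvPolynomial σ k} (hp : p ∈ supported k s)
    (h : ∀ i ∈ s, v i ∈ supported k t) : bind₁ v p ∈ supported k t :=
  algHom_mem_of_mem_supported hp fun i hi => by rw [bind₁_X_right]; exact h i hi

theorem bind₁_eq_self_of_mem_supported {v : σ → MvPolynomial σ k} (hp : p ∈ supported k s)
    (h : ∀ i ∈ s, v i = X i) : bind₁ v p = p :=
  algHom_eq_of_mem_supported (ψ := AlgHom.id k _) hp fun i hi => by
    rw [bind₁_X_right]; exact h i hi

theorem C_mem_supported (c : k) : (C c : MvPolynomial σ k) ∈ supported k s :=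
  (supported k s).algebraMap_mem c

theorem mem_supported_iff_support :
    p ∈ supported k s ↔ ∀ m ∈ p.support, ∀ i, m i ≠ 0 → i ∈ s := by
  rw [mem_supported]
  constructor
  · intro h m hm i hi
    exact h (mem_vars_iff_mem_support i |>.mpr ⟨m, hm, Finsupp.mem_support_iff.mpr hi⟩)
  · intro h i hi
    obtain ⟨m, hm, hi⟩ := (mem_vars_iff_mem_support i).mp hi
    exact h m hm i (Finsupp.mem_support_iff.mp hi)

variable [DecidableEq σ]

/-- View a polynomial as a univariate polynomial in the variable `X i`. -/
noncomputable def isolate (i : σ) : MvPolynomial σ k →ₐ[k] Polynomial (MvPolynomial σ k) :=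
  aeval fun j => if j = i then Polynomial.X else Polynomial.C (X j)

theorem isolate_X_self (i : σ) : isolate (k := k) i (X i) = Polynomial.X := by
  simp [isolate]

theorem isolate_X_of_ne {i j : σ} (h : j ≠ i) :
    isolate (k := k) i (X j) = Polynomial.C (X j) := by
  simp [isolate, h]

theorem isolate_eq_C {i : σ} (hp : p ∈ supported k s) (hi : i ∉ s) :
    isolate i p = Polynomial.C p :=
  algHom_eq_of_mem_supported (ψ := Polynomial.CAlgHom (R := k)) hp fun j hj => by
    rw [isolate_X_of_ne (ne_of_mem_of_not_mem hj hi)]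
    rfl

theorem eval_isolate (i : σ) (a p : MvPolynomial σ k) :
    (isolate i p).eval a = bind₁ (Function.update X i a) p := by
  have : ((Polynomial.aeval a).restrictScalars k).comp (isolate i) =
      bind₁ (Function.update X i a) := by
    apply algHom_ext
    intro j
    rcases eq_or_ne j i with rfl | h
    · simp [isolate_X_self]
    · simp [isolate_X_of_ne h, h]
  have h := congrArg (fun φ => φ p) this
  simpa [Polynomial.aeval_def, Polynomial.eval₂_eq_eval_map] using h

theorem eval_X_isolate (i : σ) (p : MvPolynomial σ k) : (isolate i p).eval (X i) = p := by
  rw [eval_isolate, Function.update_eq_self, bind₁_X_left]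
  rfl

theorem natDegree_isolate_pos {i : σ} {m : σ →₀ ℕ} (hm : m ∈ p.support) (hi : m i ≠ 0) :
    0 < (isolate i p).natDegree := by
  by_contra! h
  have h0 := Polynomial.eq_C_of_natDegree_le_zero h
  -- Degree zero in `X i` means that setting `X i` to 0 does not change `p`.
  have h1 : p = bind₁ (Function.update X i 0) p := by
    rw [← eval_isolate, h0, Polynomial.eval_C]
    conv_lhs => rw [← eval_X_isolate i p, h0, Polynomial.eval_C]
  have h2 : p ∈ supported k ({i}ᶜ : Set σ) := by
    rw [h1]
    refine bind₁_mem_supported (s := Set.univ) (by simp) fun j _ => ?_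
    rcases eq_or_ne j i with rfl | h
    · rw [Function.update_self]; exact zero_mem _
    · rw [Function.update_of_ne h, X_mem_supported]; exact h
  exact mem_supported_iff_support.mp h2 m hm i hi rfl

end Supported

/-! ### Structure of triangular automorphisms -/

namespace PolyEnd

variable {k : Type*} [Field k] {n : ℕ}

theorem bind₁_of_mul_eq_one {f g : PolyEnd k n} (h : f * g = 1) (p : MvPolynomial (Fin n) k) :
    bind₁ g.coord (bind₁ f.coord p) = p := by
  rw [bind₁_bind₁]
  have : (fun i => bind₁ g.coord (f.coord i)) = X := congrArg coord h
  rw [this, bind₁_X_left]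
  rfl

/-- The two claims are proved together by induction: once the inverse is triangular below `i`, only
`g.coord i` can bring `X i` into `f.coord i` composed with `g`. Degrees in `X i` then multiply to 1,
so `f.coord i` is linear in `X i`, and its leading coefficient is a unit, hence a constant. -/
theorem IsTriangular.structure_aux {f g : PolyEnd k n} (hf : f.IsTriangular) (hfg : f * g = 1)
    (hgf : g * f = 1) (i : Fin n) :
    g.coord i ∈ supported k (Set.Iic i) ∧
      ∃ u : k, u ≠ 0 ∧ ∃ w ∈ supported k (Set.Iio i), f.coord i = C u * X i + w := by
  induction i using WellFoundedLT.induction with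
  | ind i ih =>
  set T := isolate i (f.coord i) with hT
  set S := isolate i (g.coord i) with hS
  let ρ := bind₁ (R := k) g.coord
  have hρ : Function.Injective ρ := Function.LeftInverse.injective (bind₁_of_mul_eq_one hgf)
  have hfgi : bind₁ g.coord (f.coord i) = X i := congrFun (congrArg coord hfg) i
  -- This is the identity `f * g = 1` in coordinate `i`, viewed as polynomials in `X i`; the
  -- coordinates `g j` with `j < i` are constants there by induction.
  have hcomp : (T.map (ρ : _ →+* MvPolynomial (Fin n) k)).comp S = Polynomial.X := by
    let Φ := ((Polynomial.aeval S).restrictScalars k).comp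
      ((Polynomial.mapAlgHom ρ).comp (isolate i))
    have hΦ : Φ (f.coord i) = (isolate i).comp ρ (f.coord i) := by
      refine algHom_eq_of_mem_supported (hf i) fun j hj => ?_
      rcases eq_or_lt_of_le (Set.mem_Iic.mp hj) with rfl | hj
      · simp [Φ, isolate_X_self, ρ, hS]
      · have : isolate i (g.coord j) = Polynomial.C (g.coord j) :=
          isolate_eq_C (ih j hj).1 (by simpa using hj)
        simp [Φ, isolate_X_of_ne hj.ne, ρ, this]
    have h2 : (isolate i).comp ρ (f.coord i) = Polynomial.X := by
      rw [AlgHom.comp_apply, show ρ (f.coord i) = X i from hfgi, isolate_X_self]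
    rw [← h2, ← hΦ]
    rfl
  have hdeg : T.natDegree = 1 := by
    have h := congrArg Polynomial.natDegree hcomp
    have hmap : (T.map (ρ : _ →+* MvPolynomial (Fin n) k)).natDegree = T.natDegree :=
      Polynomial.natDegree_map_eq_of_injective hρ T
    rw [Polynomial.natDegree_comp, Polynomial.natDegree_X, hmap] at h
    exact Nat.eq_one_of_mul_eq_one_right h
  have hTe : T = Polynomial.C (T.coeff 1) * Polynomial.X + Polynomial.C (T.coeff 0) :=
    Polynomial.eq_X_add_C_of_natDegree_le_one hdeg.le
  have hunit : IsUnit (T.coeff 1) := by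
    have h1 : IsUnit (ρ (T.coeff 1)) := by
      rw [hTe] at hcomp
      have h := congrArg (fun p => Polynomial.coeff p 1) hcomp
      simp at h
      exact IsUnit.of_mul_eq_one _ h
    have h2 := h1.map (bind₁ (R := k) f.coord)
    rwa [bind₁_of_mul_eq_one hgf] at h2
  obtain ⟨u, hu, hu1⟩ := isUnit_iff_eq_C_of_isReduced.mp hunit
  have hw : T.coeff 0 ∈ supported k (Set.Iio i) := by
    rw [Polynomial.coeff_zero_eq_eval_zero, hT, eval_isolate]
    refine bind₁_mem_supported (hf i) fun j hj => ?_
    rcases eq_or_lt_of_le (Set.mem_Iic.mp hj) with rfl | hj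
    · rw [Function.update_self]; exact zero_mem _
    · rw [Function.update_of_ne hj.ne, X_mem_supported]; exact hj
  have hfi : f.coord i = C u * X i + T.coeff 0 := by
    rw [← eval_X_isolate i (f.coord i), ← hT]
    conv_lhs => rw [hTe, hu1]
    simp
  refine ⟨?_, u, hu.ne_zero, _, hw, hfi⟩
  have hg : g.coord i = C u⁻¹ * (X i - bind₁ g.coord (T.coeff 0)) := by
    rw [← hfgi]
    conv_rhs => rw [hfi]
    rw [map_add, map_mul, bind₁_C_right, bind₁_X_right, add_sub_cancel_right, ← mul_assoc,
      ← C_mul, inv_mul_cancel₀ hu.ne_zero, C_1, one_mul]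
  rw [hg]
  refine mul_mem (C_mem_supported _) (sub_mem (X_mem_supported.mpr Set.self_mem_Iic) ?_)
  exact bind₁_mem_supported hw fun j hj =>
    supported_mono (Set.Iic_subset_Iic.mpr (le_of_lt hj)) (ih j hj).1

theorem IsTriangular.exists_coord_eq {f : PolyEnd k n} (hf : f.IsTriangular) (hu : IsUnit f)
    (i : Fin n) :
    ∃ u : k, u ≠ 0 ∧ ∃ w ∈ supported k (Set.Iio i), f.coord i = C u * X i + w := by
  obtain ⟨⟨f, g, hfg, hgf⟩, rfl⟩ := hu
  exact (hf.structure_aux hfg hgf i).2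

theorem IsTriangular.inv {f g : PolyEnd k n} (hf : f.IsTriangular) (hfg : f * g = 1)
    (hgf : g * f = 1) : g.IsTriangular := fun i => (hf.structure_aux hfg hgf i).1

theorem IsTriangular.mul {f g : PolyEnd k n} (hf : f.IsTriangular) (hg : g.IsTriangular) :
    (f * g).IsTriangular := fun i => bind₁_mem_supported (hf i) fun j hj =>
  supported_mono (Set.Iic_subset_Iic.mpr hj) (hg j)

end PolyEnd

/-! ### Bruhat decomposition and the normal form of affine-triangular automorphisms -/

/-- Column elimination from right to left: later columns clear the top entries of earlier ones, and
`e j` marks a row above which column `j` has been cleared. In the generic case the first column is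
cleared in two rows by Cramer's rule, with the minor `D` as determinant. -/
theorem exists_bruhat_columns {k : Type*} [Field k] (a : Fin 3 → Fin 3 → k) :
    ∃ (u v w : k) (e : Equiv.Perm (Fin 3)), ∀ i,
      (i < e 0 → a i 0 + u * a i 1 + v * a i 2 = 0) ∧ (i < e 1 → a i 1 + w * a i 2 = 0) ∧
      (i < e 2 → a i 2 = 0) := by
  by_cases h02 : a 0 2 = 0
  · by_cases h01 : a 0 1 = 0
    · by_cases h12 : a 1 2 = 0
      · refine ⟨0, 0, 0, 1, fun i => ?_⟩
        fin_cases i <;> simp [h02, h01, h12]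
      · refine ⟨0, 0, -a 1 1 / a 1 2, Equiv.swap 1 2, fun i => ?_⟩
        fin_cases i <;> simp [h02, h01, h12, Equiv.swap_apply_def]
    · by_cases h12 : a 1 2 = 0
      · refine ⟨-a 0 0 / a 0 1, 0, 0, Equiv.swap 0 1, fun i => ?_⟩
        fin_cases i <;> simp [h02, h01, h12, Equiv.swap_apply_def]
      · refine ⟨-a 0 0 / a 0 1, -(a 1 0 + -a 0 0 / a 0 1 * a 1 1) / a 1 2, 0,
          (finRotate 3).symm, fun i => ?_⟩
        have e0 : (finRotate 3).symm 0 = 2 := by decide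
        have e1 : (finRotate 3).symm 1 = 0 := by decide
        have e2 : (finRotate 3).symm 2 = 1 := by decide
        rw [e0, e1, e2]
        fin_cases i <;> simp [h02, h01, h12]
  · by_cases hm : a 1 1 * a 0 2 - a 0 1 * a 1 2 = 0
    · refine ⟨0, -a 0 0 / a 0 2, -a 0 1 / a 0 2, finRotate 3, fun i => ?_⟩
      have e0 : finRotate 3 0 = 1 := by decide
      have e1 : finRotate 3 1 = 2 := by decide
      have e2 : finRotate 3 2 = 0 := by decide
      rw [e0, e1, e2]
      fin_cases i <;> simp [h02]
      field_simp
      linear_combination hm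
    · obtain ⟨D, hD⟩ : ∃ D, D = a 1 1 * a 0 2 - a 0 1 * a 1 2 := ⟨_, rfl⟩
      rw [← hD] at hm
      refine ⟨(a 0 0 * a 1 2 - a 1 0 * a 0 2) / D,
        -(a 0 0 + (a 0 0 * a 1 2 - a 1 0 * a 0 2) / D * a 0 1) / a 0 2, -a 0 1 / a 0 2,
        Equiv.swap 0 2, fun i => ?_⟩
      fin_cases i <;> simp [h02, Equiv.swap_apply_def]
      field_simp
      rw [hD]
      ring

theorem MvPolynomial.eq_C_add_sum_of_totalDegree_le_one {k σ : Type*} [Field k] [Fintype σ]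
    {p : MvPolynomial σ k} (hp : p.totalDegree ≤ 1) :
    p = C (coeff 0 p) + ∑ j, C (coeff (Finsupp.single j 1) p) * X j := by
  classical
  ext m
  rw [coeff_add, coeff_C, coeff_sum]
  simp only [coeff_C_mul, coeff_X, mul_ite, mul_one, mul_zero]
  by_cases h0 : m = 0
  · subst h0
    simp
  rw [if_neg (Ne.symm h0), zero_add]
  obtain ⟨i, hi⟩ := Finsupp.ne_iff.mp h0
  by_cases h1 : m = Finsupp.single i 1
  · subst h1
    rw [Finset.sum_eq_single i]
    · simp
    · intro j _ hj
      rw [if_neg]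
      intro h
      exact hj (Finsupp.single_left_injective one_ne_zero h)
    · simp
  · rw [Finset.sum_eq_zero]
    · by_contra h
      have hd := (le_totalDegree (mem_support_iff.mpr h)).trans hp
      rw [Finsupp.sum_fintype _ _ (fun _ => rfl)] at hd
      rw [Finsupp.coe_zero, Pi.zero_apply] at hi
      rw [← Finset.add_sum_erase _ _ (Finset.mem_univ i)] at hd
      have hz : ∑ j ∈ Finset.univ.erase i, m j = 0 := by omega
      refine h1 (Finsupp.ext fun j => ?_)
      rcases eq_or_ne j i with rfl | hj
      · rw [Finsupp.single_eq_same]; omega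
      · rw [Finsupp.single_eq_of_ne hj]
        exact Finset.sum_eq_zero_iff.mp hz j (Finset.mem_erase.mpr ⟨hj, Finset.mem_univ _⟩)
    · intro j _
      by_cases hj : Finsupp.single j 1 = m
      · subst hj
        rcases eq_or_ne j i with rfl | hji
        · exact absurd rfl h1
        · simp [Finsupp.single_eq_of_ne hji.symm] at hi
      · rw [if_neg hj]

theorem isConj_units_mul {M : Type*} [Monoid M] (γ : Mˣ) (a b : M) :
    IsConj (γ * a * b) (a * (b * γ)) := by
  refine ⟨γ⁻¹, ?_⟩
  simp [SemiconjBy, mul_assoc]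

namespace PolyEnd

variable {k : Type*} [Field k] {n : ℕ}

/-- The automorphism permuting the coordinates: `xᵢ ↦ x_{e i}`. -/
noncomputable def perm (k : Type*) [Field k] (e : Equiv.Perm (Fin n)) : PolyEnd k n :=
  ⟨fun i => X (e i)⟩

theorem perm_mul_coord (e : Equiv.Perm (Fin n)) (f : PolyEnd k n) (i : Fin n) :
    (perm k e * f).coord i = f.coord (e i) := bind₁_X_right _ _

theorem perm_mul_perm_symm (e : Equiv.Perm (Fin n)) : perm k e * perm k e.symm = 1 := by
  ext1
  funext i
  rw [perm_mul_coord, one_coord]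
  exact congrArg X (e.symm_apply_apply i)

theorem perm_symm_mul_perm (e : Equiv.Perm (Fin n)) : perm k e.symm * perm k e = 1 :=
  perm_mul_perm_symm e.symm

theorem isUnit_of_mul_eq_one {f g : PolyEnd k n} (h : f * g = 1) (h' : g * f = 1) : IsUnit f :=
  ⟨⟨f, g, h, h'⟩, rfl⟩

theorem isUnit_perm (e : Equiv.Perm (Fin n)) : IsUnit (perm k e) :=
  isUnit_of_mul_eq_one (perm_mul_perm_symm e) (perm_symm_mul_perm e)

/-- The unipotent lower triangular linear map with entries `u`, `v`, `w`. -/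
noncomputable def unipotent (u v w : k) : PolyEnd k 3 :=
  ⟨![X 0, X 1 + C u * X 0, X 2 + C v * X 0 + C w * X 1]⟩

theorem unipotent_mul (u v w u' v' w' : k) :
    unipotent u v w * unipotent u' v' w' = unipotent (u + u') (v + v' + w * u') (w + w') := by
  ext1
  funext i
  fin_cases i <;> simp [mul_coord, unipotent] <;> ring

theorem unipotent_zero : unipotent (0 : k) 0 0 = 1 := by
  ext1
  funext i
  fin_cases i <;> simp [one_coord, unipotent]

theorem isUnit_unipotent (u v w : k) : IsUnit (unipotent u v w) := by
  refine isUnit_of_mul_eq_one (g := unipotent (-u) (-v + w * u) (-w)) ?_ ?_ <;>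
  · rw [unipotent_mul, ← unipotent_zero]
    congr 1 <;> ring

theorem isTriangular_unipotent (u v w : k) : (unipotent u v w).IsTriangular := by
  have hX : ∀ i j : Fin 3, j ≤ i → (X j : MvPolynomial (Fin 3) k) ∈ supported k (Set.Iic i) :=
    fun i j h => X_mem_supported.mpr h
  intro i
  fin_cases i
  · exact hX _ _ le_rfl
  · exact add_mem (hX _ _ le_rfl) (mul_mem (C_mem_supported _) (hX _ _ (by decide)))
  · exact add_mem (add_mem (hX _ _ le_rfl) (mul_mem (C_mem_supported _) (hX _ _ (by decide))))
      (mul_mem (C_mem_supported _) (hX _ _ (by decide)))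

theorem affine_form_mem_supported {p : MvPolynomial (Fin 3) k} (hp : p.totalDegree ≤ 1)
    {u v w : k} {e : Equiv.Perm (Fin 3)} {i : Fin 3}
    (h : (i < e 0 → coeff (Finsupp.single 0 1) p + u * coeff (Finsupp.single 1 1) p +
        v * coeff (Finsupp.single 2 1) p = 0) ∧
      (i < e 1 → coeff (Finsupp.single 1 1) p + w * coeff (Finsupp.single 2 1) p = 0) ∧
      (i < e 2 → coeff (Finsupp.single 2 1) p = 0)) :
    bind₁ (perm k e).coord (bind₁ (unipotent u v w).coord p) ∈ supported k (Set.Iic i) := by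
  have key : ∀ (c : k) (j : Fin 3), (i < e j → c = 0) →
      (C c * X (e j) : MvPolynomial (Fin 3) k) ∈ supported k (Set.Iic i) := by
    intro c j hc
    by_cases hij : i < e j
    · rw [hc hij, C_0, zero_mul]
      exact zero_mem _
    · exact mul_mem (C_mem_supported _) (X_mem_supported.mpr (not_lt.mp hij))
  have hmem := add_mem (C_mem_supported (coeff 0 p))
    (add_mem (add_mem (key _ 0 h.1) (key _ 1 h.2.1)) (key _ 2 h.2.2))
  have hp' := eq_C_add_sum_of_totalDegree_le_one hp
  rw [Fin.sum_univ_three] at hp'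
  revert hp' hmem
  clear h
  generalize coeff 0 p = c
  generalize coeff (Finsupp.single 0 1) p = a0
  generalize coeff (Finsupp.single 1 1) p = a1
  generalize coeff (Finsupp.single 2 1) p = a2
  rintro hmem rfl
  convert hmem using 1
  simp only [map_add, map_mul, bind₁_C_right, bind₁_X_right, unipotent, perm,
    Matrix.cons_val_zero, Matrix.cons_val_one, Matrix.cons_val]
  ring

theorem IsAffineTriangular.exists_isConj_perm_mul {g : PolyEnd k 3} (hg : IsUnit g)
    (h : g.IsAffineTriangular) :
    ∃ (e : Equiv.Perm (Fin 3)) (τ : PolyEnd k 3), IsUnit τ ∧ τ.IsTriangular ∧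
      IsConj g (perm k e * τ) := by
  obtain ⟨α, τ, ⟨hα, hdeg⟩, hτ, rfl⟩ := h
  obtain ⟨u, v, w, e, he⟩ :=
    exists_bruhat_columns fun i j => coeff (Finsupp.single j 1) (α.coord i)
  obtain ⟨β, hβ⟩ := isUnit_unipotent u v w
  have hβt : (β : PolyEnd k 3).IsTriangular := by
    rw [hβ]; exact isTriangular_unipotent u v w
  have hγ : IsUnit (α * β * perm k e) := (hα.mul β.isUnit).mul (isUnit_perm e)
  have hγt : (α * β * perm k e).IsTriangular := by
    intro i
    have h1 : (α * β * perm k e).coord i = bind₁ (perm k e).coord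
        (bind₁ (β : PolyEnd k 3).coord (α.coord i)) := rfl
    rw [h1, hβ]
    exact affine_form_mem_supported ((α.totalDegree_coord_le i).trans hdeg.le) (he i)
  obtain ⟨γ, hγe⟩ := hγ
  rw [← hγe] at hγt
  have hγi : (↑γ⁻¹ : PolyEnd k 3).IsTriangular := hγt.inv γ.mul_inv γ.inv_mul
  have hβi : (↑β⁻¹ : PolyEnd k 3).IsTriangular := hβt.inv β.mul_inv β.inv_mul
  have hτu : IsUnit τ := by
    obtain ⟨a, ha⟩ := hα
    rw [← ha] at hg
    exact (Units.isUnit_units_mul a τ).mp hg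
  -- With γ = αβπ triangular, α = γπ⁻¹β⁻¹; moving γ to the right end by conjugation leaves π⁻¹ times
  -- a triangular automorphism.
  have hα2 : α = γ * perm k e.symm * ↑β⁻¹ := by
    rw [hγe, mul_assoc (α * β), perm_mul_perm_symm, mul_one, Units.mul_inv_cancel_right]
  have h1 : IsUnit (↑β⁻¹ * τ * γ : PolyEnd k 3) := (β⁻¹.isUnit.mul hτu).mul γ.isUnit
  have h2 : (↑β⁻¹ * τ * γ : PolyEnd k 3).IsTriangular := (hβi.mul hτ).mul hγt
  have h3 : IsConj (α * τ) (perm k e.symm * (↑β⁻¹ * τ * γ)) := by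
    rw [hα2, mul_assoc _ _ τ]
    exact isConj_units_mul γ _ _
  exact ⟨_, _, h1, h2, h3⟩

end PolyEnd

/-! ### The quadratic equation and its arithmetic -/

section Quadratic

variable {r s t : ℕ}

/-- The larger root of `x² - (r + s + t) x + r s`. -/
noncomputable def rstRoot (r s t : ℕ) : ℝ :=
  ((r + s + t : ℝ) + √((r + s + t : ℝ) ^ 2 - 4 * (r * s))) / 2

/-- In completed-square form, this says that the quadratic is negative at s + 1, where its value is
-(r + (t - 1)(s + 1)). -/
theorem rst_discrim_gt (hr : 1 ≤ r) (ht : 1 ≤ t) :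
    (2 * (s + 1 : ℝ) - (r + s + t)) ^ 2 < (r + s + t : ℝ) ^ 2 - 4 * (r * s) := by
  have hr' : (1 : ℝ) ≤ r := by exact_mod_cast hr
  have ht' : (1 : ℝ) ≤ t := by exact_mod_cast ht
  have hs' : (0 : ℝ) ≤ s := Nat.cast_nonneg s
  nlinarith [mul_nonneg (add_nonneg hs' zero_le_one) (sub_nonneg.mpr ht')]

theorem lt_rstRoot (hr : 1 ≤ r) (ht : 1 ≤ t) : (s : ℝ) + 1 < rstRoot r s t := by
  have := Real.lt_sqrt_of_sq_lt (rst_discrim_gt (s := s) hr ht)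
  rw [rstRoot]
  linarith

theorem isGreatest_rstRoot (hr : 1 ≤ r) (ht : 1 ≤ t) :
    IsGreatest {x : ℝ | x ^ 2 - ((r : ℝ) + s + t) * x + (r : ℝ) * s = 0} (rstRoot r s t) := by
  have hD : 0 ≤ (r + s + t : ℝ) ^ 2 - 4 * (r * s) :=
    (sq_nonneg _).trans (rst_discrim_gt (s := s) hr ht).le
  have hsq := Real.sq_sqrt hD
  constructor
  · rw [Set.mem_ofPred_eq, rstRoot]
    linear_combination hsq / 4
  · intro x hx
    rw [Set.mem_ofPred_eq] at hx
    have h : 2 * x - (r + s + t) ≤ √((r + s + t : ℝ) ^ 2 - 4 * (r * s)) := by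
      refine Real.le_sqrt_of_sq_le (le_of_eq ?_)
      linear_combination 4 * hx
    rw [rstRoot]
    linarith

/-- A rational root of an integral monic quadratic polynomial is an integer. -/
theorem exists_int_eq_of_quadratic {b c : ℤ} {x : ℚ} (h : x ^ 2 - b * x + c = 0) :
    ∃ m : ℤ, x = m := by
  have hx : IsIntegral ℤ x := by
    refine ⟨Polynomial.X ^ 2 - Polynomial.C b * Polynomial.X + Polynomial.C c, by monicity!, ?_⟩
    rw [Polynomial.eval₂_add, Polynomial.eval₂_sub, Polynomial.eval₂_mul, Polynomial.eval₂_pow,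
      Polynomial.eval₂_X, Polynomial.eval₂_C, Polynomial.eval₂_C]
    exact h
  obtain ⟨m, hm⟩ := IsIntegrallyClosed.isIntegral_iff.mp hx
  exact ⟨m, by simpa using hm.symm⟩

theorem ne_of_sq_eq_nat_mul_add {r s B : ℕ} {L x : ℝ} (hr : 1 ≤ r) (hs : 1 ≤ s)
    (hL : L ^ 2 - B * L + r * s = 0) (hint : ∀ m : ℤ, L ≠ m) {a b : ℕ}
    (hx : x ^ 2 = a * x + b) : x ≠ L := by
  rintro rfl
  -- The difference of the two quadratic equations; its right side is positive, so `B ≠ a` and `x`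
  -- is rational.
  have h1 : ((B : ℝ) - a) * x = r * s + b := by linear_combination hx - hL
  have hpos : (0 : ℝ) < r * s + b := by
    have hr' : (1 : ℝ) ≤ r := by exact_mod_cast hr
    have hs' : (1 : ℝ) ≤ s := by exact_mod_cast hs
    positivity
  have hne : (B : ℝ) - a ≠ 0 := fun h => by
    rw [h, zero_mul] at h1
    exact hpos.ne h1
  have hxq : x = (((r * s + b) / (B - a) : ℚ) : ℝ) := by
    push_cast
    rw [eq_div_iff hne, mul_comm, h1]
  generalize ((r * s + b) / (B - a) : ℚ) = q at hxq
  subst hxq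
  have hq : q ^ 2 - ((B : ℤ) : ℚ) * q + ((r * s : ℤ) : ℚ) = 0 := by
    have : ((q ^ 2 - (B : ℚ) * q + (r : ℚ) * s : ℚ) : ℝ) = 0 := by
      push_cast
      exact hL
    push_cast
    exact_mod_cast this
  obtain ⟨m, hm⟩ := exists_int_eq_of_quadratic hq
  exact hint m (by rw [hm]; simp)

end Quadratic

/-! ### The dynamical degree of the given map -/

namespace PolyEnd

variable {k : Type*} [Field k]

theorem isUnit_rstMap (r s t : ℕ) : IsUnit (rstMap k r s t) := by
  refine isUnit_of_mul_eq_one (g := ⟨![X 2 - X 1 ^ s * X 0,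
    X 0 - (X 2 - X 1 ^ s * X 0) ^ r * X 1 ^ t, X 1]⟩) ?_ ?_ <;>
  · ext1
    funext i
    fin_cases i <;> simp [mul_coord, one_coord, rstMap]

theorem dynamicalDegree_rstMap {r s t : ℕ} (hr : 1 ≤ r) (ht : 1 ≤ t) :
    (rstMap k r s t).dynamicalDegree = rstRoot r s t := by
  set θ := rstRoot r s t with hθ
  have hgt : (s : ℝ) + 1 < θ := lt_rstRoot hr ht
  have hroot : θ ^ 2 - ((r : ℝ) + s + t) * θ + (r : ℝ) * s = 0 := (isGreatest_rstRoot hr ht).1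
  have hs0 : (0 : ℝ) ≤ s := Nat.cast_nonneg s
  -- The second coordinate forces `μ 2 = θ * μ 1`, the third then forces `μ 0 = θ - s`, and the
  -- first becomes r(θ - s) + tθ = θ(θ - s), the quadratic equation. As θ > s + 1, the terms dropped
  -- in `G` have strictly smaller weight.
  let μ : Fin 3 → ℝ := ![θ - s, 1, θ]
  let G : PolyEnd k 3 := ⟨![X 0 ^ r * X 2 ^ t, X 2, X 2 ^ s * (X 0 ^ r * X 2 ^ t)]⟩
  have hX : ∀ i : Fin 3, HasLead μ (X i : MvPolynomial (Fin 3) k) (μ i) (X i) :=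
    fun i => (isWeightedHomogeneous_X k μ i).hasLead
  have hμ0 : μ 0 = θ - s := rfl
  have hμ1 : μ 1 = 1 := rfl
  have hμ2 : μ 2 = θ := rfl
  have h0 : HasLead μ (X 1 + X 0 ^ r * X 2 ^ t : MvPolynomial (Fin 3) k) (θ * (θ - s))
      (X 0 ^ r * X 2 ^ t) := by
    have h := ((hX 0).pow r).mul ((hX 2).pow t)
    rw [hμ0, hμ2, show r * (θ - s) + t * θ = θ * (θ - s) by linear_combination -hroot] at h
    rw [add_comm]
    refine h.add_wtLT ((wtLE_X 1).wtLT ?_)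
    rw [hμ1]
    nlinarith
  have hlead : ∀ i, HasLead μ ((rstMap k r s t).coord i) (θ * μ i) (G.coord i) := by
    intro i
    fin_cases i
    · exact h0
    · have h := hX 2
      rw [hμ2] at h
      change HasLead μ (X 2) (θ * 1) (X 2)
      rwa [mul_one]
    · have h := ((hX 2).pow s).mul h0
      rw [hμ2, show s * θ + θ * (θ - s) = θ * θ by ring] at h
      change HasLead μ (X 0 + X 2 ^ s * (X 1 + X 0 ^ r * X 2 ^ t)) (θ * θ)
        (X 2 ^ s * (X 0 ^ r * X 2 ^ t))
      rw [add_comm]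
      refine h.add_wtLT ((wtLE_X 0).wtLT ?_)
      rw [hμ0]
      nlinarith
  have hμpos : ∀ i, 0 < μ i := by
    intro i
    fin_cases i
    · change 0 < θ - s
      linarith
    · exact one_pos
    · change 0 < θ
      linarith
  -- `G` consists of monomials with coefficient 1, so it fixes the point (1, 1, 1) and its iterates
  -- cannot vanish, in any characteristic.
  have hG : ∀ m i, aeval (fun _ => (1 : k)) ((G ^ m).coord i) = 1 := by
    intro m
    induction m with
    | zero => intro i; simp [one_coord]
    | succ m ih =>
      intro i
      rw [pow_succ', mul_coord, aeval_bind₁]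
      simp only [ih]
      fin_cases i <;> simp [G]
  have hu := isUnit_rstMap (k := k) r s t
  have hθ0 : 0 < θ := hμpos 2
  refine le_antisymm (dynamicalDegree_le_of_wtLE hu hθ0 hμpos fun i => (hlead i).wtLE)
    (le_dynamicalDegree_of_hasLead hu hθ0 hlead (hμpos 0) fun m h => ?_)
  have := hG m 0
  rw [h, map_zero] at this
  exact zero_ne_one this

end PolyEnd

/-! ### Injectivity of substitutions, for nonvanishing of iterated leading parts -/

section Injectivity

variable {σ k : Type*} [Field k]

theorem exists_aeval_eq_of_mem_supported {i : σ} {p : MvPolynomial σ k}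
    (hp : p ∈ supported k {i}) : ∃ q : Polynomial k, Polynomial.aeval (X i) q = p := by
  have : p ∈ (Polynomial.aeval (R := k) (X i : MvPolynomial σ k)).range :=
    algHom_mem_of_mem_supported (φ := AlgHom.id k _) hp fun j hj => by
      rw [Set.mem_singleton_iff.mp hj]
      exact ⟨Polynomial.X, Polynomial.aeval_X _⟩
  exact this

variable [DecidableEq σ]

theorem Polynomial.eq_zero_of_comp_eq_zero {R : Type*} [CommRing R] [IsDomain R]
    {p q : Polynomial R} (hq : 0 < q.natDegree) (h : p.comp q = 0) : p = 0 := by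
  rcases Polynomial.comp_eq_zero_iff.mp h with h | ⟨-, h⟩
  · exact h
  · rw [h, Polynomial.natDegree_C] at hq
    exact absurd hq (lt_irrefl 0)

theorem injective_aeval_of_isolate {u : MvPolynomial σ k} {w : σ}
    (hu : 0 < (isolate w u).natDegree) :
    Function.Injective (Polynomial.aeval (R := k) u) := by
  rw [injective_iff_map_eq_zero]
  intro p hp
  have h : (p.map (C : k →+* MvPolynomial σ k)).comp (isolate w u) = 0 := by
    have h1 : isolate w (Polynomial.aeval u p) = 0 := by rw [hp, map_zero]
    rw [← Polynomial.aeval_algHom_apply] at h1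
    rw [Polynomial.comp, Polynomial.eval₂_map]
    exact h1
  exact (Polynomial.map_eq_zero_iff (C_injective σ k)).mp (Polynomial.eq_zero_of_comp_eq_zero hu h)

theorem eq_zero_of_bind₁_eq_zero_of_mem_supported_singleton {g : σ → MvPolynomial σ k} {i w : σ}
    (hg : 0 < (isolate w (g i)).natDegree) {p : MvPolynomial σ k} (hp : p ∈ supported k {i})
    (h : bind₁ g p = 0) : p = 0 := by
  obtain ⟨q, rfl⟩ := exists_aeval_eq_of_mem_supported hp
  rw [← Polynomial.aeval_algHom_apply, bind₁_X_right] at h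
  rw [(injective_iff_map_eq_zero _).mp (injective_aeval_of_isolate hg) q h, map_zero]

/-- Write `p` as a polynomial in `X i` over `k[X j]`. Since `g j` is free of `X v` while `g i` has
positive degree in it, comparing degrees in `X v` kills every coefficient after substitution of `g
j`, and `g j` is transcendental over `k`. -/
theorem eq_zero_of_bind₁_eq_zero_of_mem_supported_pair {g : σ → MvPolynomial σ k} {i j v w : σ}
    (hvw : v ≠ w) (hv : 0 < (isolate v (g i)).natDegree) (hw : 0 < (isolate w (g j)).natDegree)
    (hj : g j ∈ supported k {w}) {p : MvPolynomial σ k} (hp : p ∈ supported k {i, j})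
    (h : bind₁ g p = 0) : p = 0 := by
  let ι : Polynomial (Polynomial k) →ₐ[k] MvPolynomial σ k :=
    Polynomial.eval₂AlgHom (Polynomial.aeval (X j)) (X i) fun _ => Commute.all _ _
  have hι : ∀ q, ι q = Polynomial.eval₂
      ((Polynomial.aeval (R := k) (X j : MvPolynomial σ k)) : _ →+* _) (X i) q := fun _ => rfl
  have hr : p ∈ ι.range := algHom_mem_of_mem_supported (φ := AlgHom.id k _) hp fun l hl => by
    rcases hl with rfl | hl
    · exact ⟨Polynomial.X, by simp [hι]⟩
    · rw [Set.mem_singleton_iff.mp hl]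
      exact ⟨Polynomial.C Polynomial.X, by simp [hι]⟩
  obtain ⟨q, hq⟩ : ∃ q, ι q = p := hr
  rw [← hq] at h ⊢
  have hC : (((isolate v).comp (bind₁ (R := k) g)).comp (Polynomial.aeval (X j))) =
      (Polynomial.CAlgHom (R := k)).comp (Polynomial.aeval (R := k) (g j)) := by
    apply Polynomial.algHom_ext
    have : isolate v (g j) = Polynomial.C (g j) :=
      isolate_eq_C hj fun h => hvw (Set.mem_singleton_iff.mp h)
    simp [this]
  have h2 : (q.map ((Polynomial.aeval (R := k) (g j)) : _ →+* MvPolynomial σ k)).comp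
      (isolate v (g i)) = 0 := by
    have h3 : ((isolate v).comp (bind₁ (R := k) g) :
        MvPolynomial σ k →+* Polynomial (MvPolynomial σ k)) (ι q) = 0 := by
      change isolate v (bind₁ g (ι q)) = 0
      rw [h, map_zero]
    rw [hι, Polynomial.hom_eval₂] at h3
    rw [Polynomial.comp, Polynomial.eval₂_map]
    have h4 := congrArg (fun φ : Polynomial k →ₐ[k] Polynomial (MvPolynomial σ k) =>
      (φ : Polynomial k →+* Polynomial (MvPolynomial σ k))) hC
    convert h3 using 2
    · exact h4.symm
    · simp
  have h5 := Polynomial.eq_zero_of_comp_eq_zero hv h2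
  have h6 : q = 0 := (Polynomial.map_eq_zero_iff (injective_aeval_of_isolate hw)).mp h5
  rw [h6, map_zero]

end Injectivity

namespace PolyEnd

variable {k : Type*} [Field k] {n : ℕ} {G : PolyEnd k n}

theorem pow_coord_ne_zero {i : Fin n} {s : Set (Fin n)} (hi : i ∈ s)
    (hs : ∀ j ∈ s, G.coord j ∈ supported k s)
    (hinj : ∀ p ∈ supported k s, bind₁ G.coord p = 0 → p = 0) (m : ℕ) :
    (G ^ m).coord i ≠ 0 := by
  suffices h : (G ^ m).coord i ∈ supported k s ∧ (G ^ m).coord i ≠ 0 from h.2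
  induction m with
  | zero => exact ⟨X_mem_supported.mpr hi, X_ne_zero i⟩
  | succ m ih =>
    rw [pow_succ, mul_coord]
    exact ⟨bind₁_mem_supported ih.1 hs, fun h => ih.2 (hinj _ ih.1 h)⟩

end PolyEnd

/-! ### Weights and supports in three variables -/

section ThreeVariables

variable {k : Type*} [Field k] {p : MvPolynomial (Fin 3) k}

theorem weight_vec_three (a b c : ℝ) (m : Fin 3 →₀ ℕ) :
    Finsupp.weight ![a, b, c] m = m 0 * a + m 1 * b + m 2 * c := by
  simp [Finsupp.weight_eq_sum, Fin.sum_univ_three]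

theorem apply_two_eq_zero (hp : p ∈ supported k {0, 1}) {m : Fin 3 →₀ ℕ} (hm : m ∈ p.support) :
    m 2 = 0 := by
  by_contra h
  have := mem_supported_iff_support.mp hp m hm 2 h
  simp at this

theorem supported_zero_le : supported k ({0} : Set (Fin 3)) ≤ supported k {0, 1} :=
  supported_mono (by simp)

theorem apply_one_eq_zero (hp : p ∈ supported k {0}) {m : Fin 3 →₀ ℕ} (hm : m ∈ p.support) :
    m 1 = 0 := by
  by_contra h
  have := mem_supported_iff_support.mp hp m hm 1 h
  simp at this

theorem mem_supported_zero_of_apply_one_eq_zero (hp : p ∈ supported k {0, 1})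
    (h : ∀ m ∈ p.support, m 1 = 0) : p ∈ supported k {0} := by
  rw [mem_supported_iff_support] at hp ⊢
  intro m hm i hi
  rcases hp m hm i hi with h0 | h1
  · exact h0
  · rw [Set.mem_singleton_iff.mp h1] at hi
    exact absurd (h m hm) hi

theorem wtLE_of_mem_supported_pair {a b c W : ℝ} (hp : p ∈ supported k {0, 1})
    (h : ∀ m ∈ p.support, (m 0 * a + m 1 * b : ℝ) ≤ W) : WtLE ![a, b, c] p W := by
  intro m hm
  rw [weight_vec_three, apply_two_eq_zero hp hm]
  simpa using h m hm

theorem wtLE_of_mem_supported_zero {a b c W : ℝ} (hp : p ∈ supported k {0})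
    (h : ∀ m ∈ p.support, (m 0 * a : ℝ) ≤ W) : WtLE ![a, b, c] p W :=
  wtLE_of_mem_supported_pair (supported_zero_le hp) fun m hm => by
    rw [apply_one_eq_zero hp hm]
    simpa using h m hm

theorem apply_add_apply_le_totalDegree {m : Fin 3 →₀ ℕ} (hm : m ∈ p.support) :
    (m 0 + m 1 : ℝ) ≤ p.totalDegree := by
  have h := le_totalDegree hm
  rw [Finsupp.sum_fintype _ _ (fun _ => rfl), Fin.sum_univ_three] at h
  have h' : m 0 + m 1 ≤ p.totalDegree := by omega
  exact_mod_cast h'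

theorem apply_le_totalDegree {m : Fin 3 →₀ ℕ} (hm : m ∈ p.support) (i : Fin 3) :
    (m i : ℝ) ≤ p.totalDegree := by
  have h := le_totalDegree hm
  rw [Finsupp.sum_fintype _ _ (fun _ => rfl)] at h
  exact_mod_cast (Finset.single_le_sum (fun _ _ => Nat.zero_le _) (Finset.mem_univ i)).trans h

theorem component_mem_supported {σ : Type*} {μ : σ → ℝ} {W : ℝ} {s : Set σ}
    {p : MvPolynomial σ k} (hp : p ∈ supported k s) :
    weightedHomogeneousComponent μ W p ∈ supported k s := by
  rw [mem_supported_iff_support] at hp ⊢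
  exact fun m hm => hp m (mem_support_component.mp hm).1

theorem natDegree_isolate_zero_pos {a b c W : ℝ} (hp : p ∈ supported k {0}) (h0 : p ≠ 0)
    (hom : IsWeightedHomogeneous ![a, b, c] p W) (hW : 0 < W) :
    0 < (isolate 0 p).natDegree := by
  obtain ⟨m, hm⟩ := support_nonempty.mpr h0
  refine natDegree_isolate_pos hm fun h => ?_
  have := hom (mem_support_iff.mp hm)
  rw [weight_vec_three, apply_two_eq_zero (supported_zero_le hp) hm, apply_one_eq_zero hp hm,
    h] at this
  simp at this
  exact hW.ne this

end ThreeVariables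

/-! ### The quadratic equation from a two-variable leading part -/

namespace PolyEnd

variable {k : Type*} [Field k]

/-- The positive root of `x² = i x + j`. -/
noncomputable def posRoot (i j : ℝ) : ℝ := (i + √(i ^ 2 + 4 * j)) / 2

theorem posRoot_sq {i j : ℝ} (hj : 0 ≤ j) : posRoot i j ^ 2 = i * posRoot i j + j := by
  have := Real.sq_sqrt (show 0 ≤ i ^ 2 + 4 * j by positivity)
  rw [posRoot]
  linear_combination this / 4

theorem le_sq_of_posRoot_le {i j θ : ℝ} (hi : 0 ≤ i) (hj : 0 ≤ j) (h : posRoot i j ≤ θ) :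
    i * θ + j ≤ θ ^ 2 := by
  have h1 : i ≤ posRoot i j := by
    have : i ≤ √(i ^ 2 + 4 * j) := Real.le_sqrt_of_sq_le (by linarith)
    rw [posRoot]
    linarith
  nlinarith [posRoot_sq (i := i) hj, mul_nonneg (sub_nonneg.mpr h)
    (show 0 ≤ θ + posRoot i j - i by linarith)]

/-- `x` is a root of `X² - a X - b` for some natural numbers `a`, `b`. -/
def IsNatQuadratic (x : ℝ) : Prop := ∃ a b : ℕ, x ^ 2 = a * x + b

theorem isNatQuadratic_natCast (m : ℕ) : IsNatQuadratic (m : ℝ) := ⟨m, 0, by push_cast; ring⟩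

theorem isNatQuadratic_of_le_one {f : PolyEnd k 3} (hf : IsUnit f)
    (h : f.dynamicalDegree ≤ 1) : IsNatQuadratic f.dynamicalDegree := by
  rw [h.antisymm (one_le_dynamicalDegree hf)]
  exact_mod_cast isNatQuadratic_natCast 1

/-- The dynamical degree of an automorphism whose leading part is `(h(x, y), u(x), *)`
for a suitable weight. -/
theorem isNatQuadratic_of_lead {f : PolyEnd k 3} (hf : IsUnit f) {q : MvPolynomial (Fin 3) k}
    (hq : q ∈ supported k {0, 1}) {d : ℕ} (hd : 1 ≤ d)
    (H : ∀ θ : ℝ, 1 < θ → ∃ ν : ℝ, 0 < ν ∧ WtLT ![θ, d, ν] (f.coord 0 - q) (θ ^ 2) ∧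
      (∃ u ∈ supported k {0}, u ≠ 0 ∧ HasLead ![θ, d, ν] (f.coord 1) (θ * d) u) ∧
      WtLE ![θ, d, ν] (f.coord 2) (θ * ν)) :
    IsNatQuadratic f.dynamicalDegree := by
  have hd0 : (0 : ℝ) < d := by exact_mod_cast hd
  -- A monomial xⁱyʲ has weight iθ + jd, which is at most θ² as soon as θ is at least the positive
  -- root of X² = iX + jd. The largest of these roots over `q` will be λ(f) if it exceeds 1;
  -- otherwise λ(f) = 1.
  let ρ : (Fin 3 →₀ ℕ) → ℝ := fun m => posRoot (m 0) (m 1 * d)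
  have hWq : ∀ θ ν : ℝ, (∀ m ∈ q.support, ρ m ≤ θ) → WtLE ![θ, d, ν] q (θ ^ 2) :=
    fun θ ν h => wtLE_of_mem_supported_pair hq fun m hm =>
      le_sq_of_posRoot_le (by positivity) (by positivity) (h m hm)
  have upper : ∀ θ : ℝ, 1 < θ → (∀ m ∈ q.support, ρ m ≤ θ) → f.dynamicalDegree ≤ θ := by
    intro θ hθ h
    obtain ⟨ν, hν, h0, ⟨u, -, -, h1⟩, h2⟩ := H θ hθ
    refine dynamicalDegree_le_of_wtLE (μ := ![θ, d, ν]) hf (by linarith) ?_ ?_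
    · intro i
      fin_cases i
      · change 0 < θ
        linarith
      · exact hd0
      · exact hν
    · intro i
      fin_cases i
      · change WtLE _ (f.coord 0) (θ * θ)
        rw [← sub_add_cancel (f.coord 0) q, ← sq]
        exact h0.wtLE.add (hWq θ ν h)
      · exact h1.wtLE
      · exact h2
  by_cases hall : ∀ m ∈ q.support, ρ m ≤ 1
  · exact isNatQuadratic_of_le_one hf (le_of_forall_gt_imp_ge_of_dense fun θ hθ =>
      upper θ hθ fun m hm => (hall m hm).trans (le_of_lt hθ))
  push Not at hall
  obtain ⟨m₀, hm₀, hlt⟩ := hall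
  obtain ⟨m, hm, hmax⟩ := Finset.exists_max_image q.support ρ ⟨m₀, hm₀⟩
  have hθ : 1 < ρ m := hlt.trans_le (hmax m₀ hm₀)
  have hsq : ρ m ^ 2 = m 0 * ρ m + m 1 * d := posRoot_sq (by positivity)
  suffices hdeg : f.dynamicalDegree = ρ m by
    refine ⟨m 0, m 1 * d, ?_⟩
    rw [hdeg]
    exact_mod_cast hsq
  refine (upper _ hθ hmax).antisymm ?_
  generalize ρ m = θ at *
  have hθ0 : 0 < θ := by linarith
  obtain ⟨ν, hν, h0, ⟨u, hu, hu0, h1⟩, h2⟩ := H θ hθ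
  have hWq' := (hWq θ ν hmax).hasLead_component
  obtain ⟨h, hh⟩ : ∃ h, h = weightedHomogeneousComponent ![θ, d, ν] (θ ^ 2) q := ⟨_, rfl⟩
  have hmh : m ∈ h.support := by
    rw [hh, mem_support_component, weight_vec_three, apply_two_eq_zero hq hm, hsq]
    exact ⟨hm, by simp⟩
  have hhs : h ∈ supported k {0, 1} := by
    rw [hh]
    exact component_mem_supported hq
  rw [← hh] at hWq'
  clear hh
  have hupos := natDegree_isolate_zero_pos hu hu0 h1.1 (by positivity)
  let G : PolyEnd k 3 :=
    ⟨![h, u, weightedHomogeneousComponent ![θ, d, ν] (θ * ν) (f.coord 2)]⟩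
  refine le_dynamicalDegree_of_hasLead (μ := ![θ, d, ν]) (G := G) (i := 0) hf hθ0 ?_ hθ0 ?_
  · intro i
    fin_cases i
    · change HasLead _ (f.coord 0) (θ * θ) h
      rw [← sub_add_cancel (f.coord 0) q, ← sq, add_comm]
      exact hWq'.add_wtLT h0
    · exact h1
    · exact h2.hasLead_component
  -- If `h` involves only x, it is iterated inside k[x]. Otherwise the pair (h, u) defines an
  -- injective substitution of k[x, y].
  by_cases hy : ∀ m ∈ h.support, m 1 = 0
  · have hhs' : h ∈ supported k {0} := mem_supported_zero_of_apply_one_eq_zero hhs hy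
    have hhpos : 0 < (isolate 0 (G.coord 0)).natDegree :=
      natDegree_isolate_zero_pos hhs' (support_nonempty.mp ⟨m, hmh⟩) hWq'.1 (by positivity)
    refine pow_coord_ne_zero (s := {0}) (Set.mem_singleton 0) ?_ ?_
    · intro j hj
      rw [Set.mem_singleton_iff.mp hj]
      exact hhs'
    · exact fun p hp => eq_zero_of_bind₁_eq_zero_of_mem_supported_singleton hhpos hp
  · push Not at hy
    obtain ⟨m', hm', hy⟩ := hy
    have hhpos : 0 < (isolate 1 (G.coord 0)).natDegree := natDegree_isolate_pos hm' hy
    have hupos' : 0 < (isolate 0 (G.coord 1)).natDegree := hupos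
    have hu' : G.coord 1 ∈ supported k {0} := hu
    refine pow_coord_ne_zero (s := {0, 1}) (Set.mem_insert 0 _) ?_ ?_
    · rintro j (rfl | hj)
      · exact hhs
      · rw [Set.mem_singleton_iff.mp hj]
        exact supported_zero_le hu
    · exact fun p hp => eq_zero_of_bind₁_eq_zero_of_mem_supported_pair (by decide) hhpos hupos'
        hu' hp

end PolyEnd

/-! ### Permuted triangular maps treated directly by weights -/

namespace PolyEnd

variable {k : Type*} [Field k] {f : PolyEnd k 3} {p q : MvPolynomial (Fin 3) k} {a b c e e' : k}

/-- Weights growing fast enough along the variables dominate `p` and `q` already for θ = 1, so λ =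
1. -/
theorem isNatQuadratic_of_triangular (hf : IsUnit f) (hp : p ∈ supported k {0})
    (hq : q ∈ supported k {0, 1}) (h0 : f.coord 0 = C a * X 0 + C e)
    (h1 : f.coord 1 = C b * X 1 + p) (h2 : f.coord 2 = C c * X 2 + q) :
    IsNatQuadratic f.dynamicalDegree := by
  refine isNatQuadratic_of_le_one hf (dynamicalDegree_le_of_wtLE
    (μ := ![1, p.totalDegree + 1, (q.totalDegree + 1) * (p.totalDegree + 1)]) hf one_pos ?_ ?_)
  · intro i
    fin_cases i
    · exact one_pos
    · change (0 : ℝ) < p.totalDegree + 1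
      positivity
    · change (0 : ℝ) < (q.totalDegree + 1) * (p.totalDegree + 1)
      positivity
  · intro i
    rw [one_mul]
    fin_cases i
    · change WtLE _ (f.coord 0) 1
      rw [h0]
      exact (wtLE_C_mul_X a 0).add ((wtLE_C e).mono zero_le_one)
    · change WtLE _ (f.coord 1) (p.totalDegree + 1)
      rw [h1]
      refine (wtLE_C_mul_X b 1).add (wtLE_of_mem_supported_zero hp fun m hm => ?_)
      change (m 0 * 1 : ℝ) ≤ p.totalDegree + 1
      linarith [apply_le_totalDegree hm 0]
    · change WtLE _ (f.coord 2) ((q.totalDegree + 1) * (p.totalDegree + 1))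
      rw [h2]
      refine (wtLE_C_mul_X c 2).add (wtLE_of_mem_supported_pair hq fun m hm => ?_)
      have h := apply_add_apply_le_totalDegree hm
      have hp0 : (0 : ℝ) ≤ p.totalDegree := Nat.cast_nonneg _
      have hm0 : (0 : ℝ) ≤ m 0 := Nat.cast_nonneg _
      change (m 0 * 1 + m 1 * (p.totalDegree + 1) : ℝ) ≤
        (q.totalDegree + 1) * (p.totalDegree + 1)
      nlinarith [mul_nonneg hm0 hp0, mul_le_mul_of_nonneg_right h hp0]

theorem hasLead_C_mul_X_add_C {μ : Fin 3 → ℝ} (a e : k) (i : Fin 3) (hi : 0 < μ i) :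
    HasLead μ (C a * X i + C e) (μ i) (C a * X i) :=
  (hasLead_C_mul_X a i).add_wtLT ((wtLE_C e).wtLT hi)

theorem C_mul_X_zero_mem_supported : (C a * X 0 : MvPolynomial (Fin 3) k) ∈ supported k {0} :=
  mul_mem (C_mem_supported a) (X_mem_supported.mpr (Set.mem_singleton 0))

theorem C_mul_X_ne_zero (ha : a ≠ 0) (i : Fin 3) : (C a * X i : MvPolynomial (Fin 3) k) ≠ 0 :=
  mul_ne_zero (C_ne_zero.mpr ha) (X_ne_zero i)

theorem isNatQuadratic_of_henon (hf : IsUnit f) (hp : p ∈ supported k {0})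
    (hq : q ∈ supported k {0, 1}) (ha : a ≠ 0) (h0 : f.coord 0 = C b * X 1 + p)
    (h1 : f.coord 1 = C a * X 0 + C e) (h2 : f.coord 2 = C c * X 2 + q) :
    IsNatQuadratic f.dynamicalDegree := by
  refine isNatQuadratic_of_lead hf (supported_zero_le hp) le_rfl fun θ hθ =>
    ⟨q.totalDegree + 1, by positivity, ?_, ⟨C a * X 0, C_mul_X_zero_mem_supported,
      C_mul_X_ne_zero ha 0, ?_⟩, ?_⟩
  · rw [h0, add_sub_cancel_right]
    refine (wtLE_C_mul_X b 1).wtLT ?_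
    change ((1 : ℕ) : ℝ) < _
    push_cast
    nlinarith
  · rw [h1, Nat.cast_one, mul_one]
    exact hasLead_C_mul_X_add_C (μ := ![θ, 1, q.totalDegree + 1]) a e 0
      (by change 0 < θ; linarith)
  · rw [h2]
    have hq0 : (0 : ℝ) ≤ q.totalDegree := Nat.cast_nonneg _
    refine WtLE.add ((wtLE_C_mul_X c 2).mono ?_) (wtLE_of_mem_supported_pair hq fun m hm => ?_)
    · change (q.totalDegree + 1 : ℝ) ≤ _
      nlinarith
    · have h := apply_add_apply_le_totalDegree hm
      have hm1 : (0 : ℝ) ≤ m 1 := Nat.cast_nonneg _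
      push_cast
      nlinarith

theorem isNatQuadratic_of_shift (hf : IsUnit f) (hq : q ∈ supported k {0, 1}) (ha : a ≠ 0)
    (h0 : f.coord 0 = C c * X 2 + q) (h1 : f.coord 1 = C a * X 0 + C e)
    (h2 : f.coord 2 = C b * X 1 + C e') : IsNatQuadratic f.dynamicalDegree := by
  refine isNatQuadratic_of_lead hf hq le_rfl fun θ hθ => ?_
  have hθ0 : 0 < θ := by linarith
  refine ⟨θ⁻¹, by positivity, ?_, ⟨C a * X 0, C_mul_X_zero_mem_supported,
      C_mul_X_ne_zero ha 0, ?_⟩, ?_⟩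
  · rw [h0, add_sub_cancel_right]
    refine (wtLE_C_mul_X c 2).wtLT ?_
    change θ⁻¹ < _
    have : θ⁻¹ < 1 := inv_lt_one_of_one_lt₀ hθ
    nlinarith
  · rw [h1, Nat.cast_one, mul_one]
    exact hasLead_C_mul_X_add_C (μ := ![θ, 1, θ⁻¹]) a e 0 hθ0
  · rw [h2, mul_inv_cancel₀ hθ0.ne', Nat.cast_one]
    exact (wtLE_C_mul_X b 1).add ((wtLE_C e').mono zero_le_one)

/-- The variable y evolves by an affine map on its own, so it contributes no growth: λ is the larger
of 1 and the x-degree `D` of `q`. -/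
theorem isNatQuadratic_of_fibered (hf : IsUnit f) (hp : p ∈ supported k {1})
    (hq : q ∈ supported k {0, 1}) (hb : b ≠ 0) (h0 : f.coord 0 = C c * X 2 + q)
    (h1 : f.coord 1 = C b * X 1 + C e) (h2 : f.coord 2 = C a * X 0 + p) :
    IsNatQuadratic f.dynamicalDegree := by
  have hp' : p ∈ supported k {0, 1} := supported_mono (by simp) hp
  have hp0 : ∀ m ∈ p.support, m 0 = 0 := by
    intro m hm
    by_contra h
    have := mem_supported_iff_support.mp hp m hm 0 h
    simp at this
  obtain ⟨D, hD⟩ : ∃ D, D = degreeOf 0 q := ⟨_, rfl⟩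
  have hDle : ∀ m ∈ q.support, m 0 ≤ D := fun m hm => by
    rw [hD, degreeOf_eq_sup]
    exact Finset.le_sup (f := fun m : Fin 3 →₀ ℕ => m 0) hm
  have upper : ∀ θ : ℝ, 1 < θ → D < θ → f.dynamicalDegree ≤ θ := by
    intro θ hθ hDθ
    have hδ : 0 < θ * (θ - D) := mul_pos (by linarith) (by linarith)
    -- `N` makes y negligible against x and z: it absorbs the y-degrees of `q`, using the gap θ - D,
    -- and the degree of `p`.
    obtain ⟨N, hN⟩ : ∃ N : ℝ, N = 1 + q.totalDegree / (θ * (θ - D)) + p.totalDegree := ⟨_, rfl⟩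
    have hq0 : (0 : ℝ) ≤ q.totalDegree / (θ * (θ - D)) := by positivity
    have hp0' : (0 : ℝ) ≤ p.totalDegree := Nat.cast_nonneg _
    have hNp : (p.totalDegree : ℝ) ≤ N := by linarith
    have hNq : (q.totalDegree : ℝ) ≤ N * (θ * (θ - D)) := by
      rw [← div_le_iff₀ hδ]
      linarith
    have hN0 : 1 ≤ N := by linarith
    have hNθ : N ≤ θ * N := by nlinarith
    refine dynamicalDegree_le_of_wtLE (μ := ![N * θ, 1, N]) hf (by linarith) ?_ ?_
    · intro i
      fin_cases i
      · change 0 < N * θ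
        positivity
      · exact one_pos
      · change 0 < N
        linarith
    · intro i
      fin_cases i
      · change WtLE _ (f.coord 0) (θ * (N * θ))
        rw [h0]
        refine WtLE.add ((wtLE_C_mul_X c 2).mono ?_) (wtLE_of_mem_supported_pair hq fun m hm => ?_)
        · change N ≤ _
          nlinarith
        · have hm0 : (m 0 : ℝ) ≤ D := by exact_mod_cast hDle m hm
          have hm1 := apply_le_totalDegree hm 1
          have : (m 0 : ℝ) * (N * θ) ≤ D * (N * θ) :=
            mul_le_mul_of_nonneg_right hm0 (by positivity)
          linarith
      · change WtLE _ (f.coord 1) (θ * 1)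
        rw [h1]
        refine WtLE.add ((wtLE_C_mul_X b 1).mono ?_) ((wtLE_C e).mono (by linarith))
        change 1 ≤ _
        linarith
      · change WtLE _ (f.coord 2) (θ * N)
        rw [h2]
        refine WtLE.add ((wtLE_C_mul_X a 0).mono (mul_comm N θ).le)
          (wtLE_of_mem_supported_pair hp' fun m hm => ?_)
        have := apply_le_totalDegree hm 1
        rw [hp0 m hm]
        push_cast
        linarith
  rcases Nat.lt_or_ge 1 D with hD1 | hD1
  · have hD1' : (1 : ℝ) < D := by exact_mod_cast hD1
    suffices h : f.dynamicalDegree = D by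
      rw [h]
      exact isNatQuadratic_natCast D
    refine le_antisymm (le_of_forall_gt_imp_ge_of_dense fun θ hθ =>
      upper θ (hD1'.trans hθ) hθ) ?_
    have hDpos : (0 : ℝ) < D := by linarith
    -- For the lower bound y may have weight 0, so all terms of `q` of x-degree `D` are leading, and
    -- the second leading coordinate keeps its constant `C e`.
    have hWq : WtLE ![D, 0, 1] q (D * D) := wtLE_of_mem_supported_pair hq fun m hm => by
      rw [mul_zero, add_zero]
      gcongr
      exact hDle m hm
    obtain ⟨h, hh⟩ : ∃ h, h = weightedHomogeneousComponent ![(D : ℝ), 0, 1] (D * D) q := ⟨_, rfl⟩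
    have hlead := hWq.hasLead_component
    rw [← hh] at hlead
    have hhs : h ∈ supported k {0, 1} := by
      rw [hh]
      exact component_mem_supported hq
    have hq0 : q ≠ 0 := by
      rintro rfl
      rw [degreeOf_zero] at hD
      omega
    obtain ⟨m, hm, hmD⟩ := Finset.exists_mem_eq_sup _ (support_nonempty.mpr hq0)
      (fun m : Fin 3 →₀ ℕ => m 0)
    rw [← degreeOf_eq_sup, ← hD] at hmD
    have hmh : m ∈ h.support := by
      rw [hh, mem_support_component, weight_vec_three, apply_two_eq_zero hq hm, ← hmD]
      exact ⟨hm, by simp⟩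
    let G : PolyEnd k 3 := ⟨![h, C b * X 1 + C e, C a * X 0]⟩
    have hu : (C b * X 1 + C e : MvPolynomial (Fin 3) k) ∈ supported k {1} :=
      add_mem (mul_mem (C_mem_supported b) (X_mem_supported.mpr (Set.mem_singleton 1)))
        (C_mem_supported e)
    have hpos0 : 0 < (isolate 0 (G.coord 0)).natDegree :=
      natDegree_isolate_pos hmh (by omega)
    have hpos1 : 0 < (isolate 1 (G.coord 1)).natDegree := by
      refine natDegree_isolate_pos (p := C b * X 1 + C e) (m := Finsupp.single 1 1) ?_ (by simp)
      rw [mem_support_iff, coeff_add, coeff_C_mul, coeff_X, coeff_C, if_pos rfl, if_neg]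
      · simpa using hb
      · exact (Finsupp.single_ne_zero.mpr one_ne_zero).symm
    refine le_dynamicalDegree_of_hasLead (μ := ![D, 0, 1]) (G := G) (i := 0) hf hDpos ?_ hDpos ?_
    · intro i
      fin_cases i
      · change HasLead _ (f.coord 0) (D * D) h
        rw [h0, add_comm]
        refine hlead.add_wtLT ((wtLE_C_mul_X c 2).wtLT ?_)
        change (1 : ℝ) < _
        nlinarith
      · change HasLead _ (f.coord 1) (D * 0) (C b * X 1 + C e)
        rw [h1, mul_zero]
        exact (hasLead_C_mul_X b 1).add (hasLead_C e)
      · change HasLead _ (f.coord 2) (D * 1) (C a * X 0)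
        rw [h2, mul_one]
        refine (hasLead_C_mul_X a 0).add_wtLT (WtLE.wtLT
          (wtLE_of_mem_supported_pair (W := 0) hp' fun m hm => ?_) hDpos)
        rw [hp0 m hm]
        simp
    · refine pow_coord_ne_zero (s := {0, 1}) (Set.mem_insert 0 _) ?_ ?_
      · rintro j (rfl | hj)
        · exact hhs
        · rw [Set.mem_singleton_iff.mp hj]
          exact supported_mono (by simp) hu
      · exact fun p hp => eq_zero_of_bind₁_eq_zero_of_mem_supported_pair (by decide) hpos0 hpos1
          hu hp
  · have hD1' : (D : ℝ) ≤ 1 := by exact_mod_cast hD1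
    exact isNatQuadratic_of_le_one hf (le_of_forall_gt_imp_ge_of_dense fun θ hθ =>
      upper θ hθ (hD1'.trans_lt hθ))

/-- If `p` has degree d > 0, giving y the weight d makes the top term of `p` the leading part of the
second coordinate. If `p` is constant, y evolves affinely and the fibered case applies. -/
theorem isNatQuadratic_of_reversal (hf : IsUnit f) (hp : p ∈ supported k {0})
    (hq : q ∈ supported k {0, 1}) (hb : b ≠ 0) (h0 : f.coord 0 = C c * X 2 + q)
    (h1 : f.coord 1 = C b * X 1 + p) (h2 : f.coord 2 = C a * X 0 + C e) :
    IsNatQuadratic f.dynamicalDegree := by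
  obtain ⟨d, hd⟩ : ∃ d, d = degreeOf 0 p := ⟨_, rfl⟩
  have hdle : ∀ m ∈ p.support, m 0 ≤ d := fun m hm => by
    rw [hd, degreeOf_eq_sup]
    exact Finset.le_sup (f := fun m : Fin 3 →₀ ℕ => m 0) hm
  rcases Nat.eq_zero_or_pos d with hd0 | hd0
  · have hpC : p = C (coeff 0 p) := by
      ext m
      rw [coeff_C]
      split_ifs with h
      · rw [h]
      · by_contra hm
        have hm' := mem_support_iff.mpr hm
        refine h (Finsupp.ext fun i => ?_)
        have hm0 := hdle m hm'
        fin_cases i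
        · change 0 = m 0
          omega
        · exact (apply_one_eq_zero hp hm').symm
        · exact (apply_two_eq_zero (supported_zero_le hp) hm').symm
    rw [hpC] at h1
    exact isNatQuadratic_of_fibered hf (C_mem_supported e) hq hb h0 h1 h2
  refine isNatQuadratic_of_lead hf hq hd0 fun θ hθ => ⟨1, one_pos, ?_, ?_, ?_⟩
  · rw [h0, add_sub_cancel_right]
    refine (wtLE_C_mul_X c 2).wtLT ?_
    change 1 < _
    nlinarith
  · have hd0' : (0 : ℝ) < d := by exact_mod_cast hd0
    have hW : WtLE ![θ, d, 1] p (θ * d) := wtLE_of_mem_supported_zero hp fun m hm => by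
      rw [mul_comm]
      gcongr
      exact hdle m hm
    refine ⟨weightedHomogeneousComponent ![θ, d, 1] (θ * d) p, component_mem_supported hp, ?_, ?_⟩
    · have hp0 : p ≠ 0 := by
        rintro rfl
        rw [degreeOf_zero] at hd
        omega
      obtain ⟨m, hm, hmd⟩ := Finset.exists_mem_eq_sup _ (support_nonempty.mpr hp0)
        (fun m : Fin 3 →₀ ℕ => m 0)
      rw [← degreeOf_eq_sup, ← hd] at hmd
      refine support_nonempty.mp ⟨m, mem_support_component.mpr ⟨hm, ?_⟩⟩
      rw [weight_vec_three, apply_two_eq_zero (supported_zero_le hp) hm, apply_one_eq_zero hp hm,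
        ← hmd]
      push_cast
      ring
    · rw [h1, add_comm]
      refine hW.hasLead_component.add_wtLT ((wtLE_C_mul_X b 1).wtLT ?_)
      change (d : ℝ) < _
      nlinarith
  · rw [h2, mul_one]
    exact (hasLead_C_mul_X_add_C (μ := ![θ, d, 1]) a e 0 (by change 0 < θ; linarith)).wtLE

end PolyEnd

/-! ### The remaining permutations, by conjugation, and the case distinction -/

namespace PolyEnd

variable {k : Type*} [Field k] {f : PolyEnd k 3} {p q : MvPolynomial (Fin 3) k} {a b c e : k}

theorem isNatQuadratic_of_semiconj {f' φ ψ : PolyEnd k 3} (hf : IsUnit f) (h1 : φ * ψ = 1)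
    (h2 : ψ * φ = 1) (h : φ * f = f' * φ)
    (hf' : IsUnit f' → IsNatQuadratic f'.dynamicalDegree) : IsNatQuadratic f.dynamicalDegree := by
  have hc : IsConj f f' := ⟨⟨φ, ψ, h1, h2⟩, h⟩
  rw [← dynamicalDegree_eq_of_isConj hc hf]
  exact hf' (isUnit_of_isConj hc hf)

theorem ext_three {f g : PolyEnd k 3} (h0 : f.coord 0 = g.coord 0) (h1 : f.coord 1 = g.coord 1)
    (h2 : f.coord 2 = g.coord 2) : f = g := by
  ext1
  funext i
  fin_cases i
  exacts [h0, h1, h2]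

theorem C_mul_C_inv_mul (ha : a ≠ 0) (p : MvPolynomial (Fin 3) k) : C a * (C a⁻¹ * p) = p := by
  rw [← mul_assoc, ← C_mul, mul_inv_cancel₀ ha, C_1, one_mul]

theorem C_inv_mul_C_mul (ha : a ≠ 0) (p : MvPolynomial (Fin 3) k) : C a⁻¹ * (C a * p) = p := by
  rw [← mul_assoc, ← C_mul, inv_mul_cancel₀ ha, C_1, one_mul]

/-- Conjugation by `(x, y, z - p((y - e) / a))`. -/
theorem isNatQuadratic_of_cycle (hf : IsUnit f) (hp : p ∈ supported k {0})
    (hq : q ∈ supported k {0, 1}) (ha : a ≠ 0) (h0 : f.coord 0 = C c * X 2 + q)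
    (h1 : f.coord 1 = C a * X 0 + C e) (h2 : f.coord 2 = C b * X 1 + p) :
    IsNatQuadratic f.dynamicalDegree := by
  let v : Fin 3 → MvPolynomial (Fin 3) k := ![C a⁻¹ * (X 1 - C e), X 1, X 2]
  have hps : bind₁ v p ∈ supported k {0, 1} := bind₁_mem_supported hp fun i hi => by
    rw [Set.mem_singleton_iff.mp hi]
    exact mul_mem (C_mem_supported _)
      (sub_mem (X_mem_supported.mpr (by simp)) (C_mem_supported _))
  have fix : ∀ (w : Fin 3 → MvPolynomial (Fin 3) k) (r : MvPolynomial (Fin 3) k),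
      r ∈ supported k {0, 1} → w 0 = X 0 → w 1 = X 1 → bind₁ w r = r := by
    intro w r hr hw0 hw1
    refine bind₁_eq_self_of_mem_supported hr fun i hi => ?_
    rcases hi with rfl | hi
    · exact hw0
    · rw [Set.mem_singleton_iff.mp hi, hw1]
  let φ : PolyEnd k 3 := ⟨![X 0, X 1, X 2 - bind₁ v p]⟩
  let ψ : PolyEnd k 3 := ⟨![X 0, X 1, X 2 + bind₁ v p]⟩
  let f' : PolyEnd k 3 := ⟨![C c * X 2 + (C c * bind₁ v p + q), C a * X 0 + C e,
    C b * X 1 + C 0]⟩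
  refine isNatQuadratic_of_semiconj (f' := f') (φ := φ) (ψ := ψ) hf ?_ ?_ ?_ fun hu =>
    isNatQuadratic_of_shift hu (add_mem (mul_mem (C_mem_supported c) hps) hq) ha rfl rfl rfl
  · refine ext_three (bind₁_X_right _ _) (bind₁_X_right _ _) ?_
    change bind₁ ψ.coord (X 2 - bind₁ v p) = X 2
    rw [map_sub, bind₁_X_right, fix ψ.coord _ hps rfl rfl]
    exact add_sub_cancel_right _ _
  · refine ext_three (bind₁_X_right _ _) (bind₁_X_right _ _) ?_
    change bind₁ φ.coord (X 2 + bind₁ v p) = X 2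
    rw [map_add, bind₁_X_right, fix φ.coord _ hps rfl rfl]
    exact sub_add_cancel _ _
  · have hvp : bind₁ f.coord (bind₁ v p) = p := by
      rw [bind₁_bind₁]
      refine bind₁_eq_self_of_mem_supported hp fun i hi => ?_
      rw [Set.mem_singleton_iff.mp hi]
      simp [v, h1, C_inv_mul_C_mul ha]
    have hφ0 : φ.coord 0 = X 0 := rfl
    have hφ1 : φ.coord 1 = X 1 := rfl
    have hφ2 : φ.coord 2 = X 2 - bind₁ v p := rfl
    refine ext_three ?_ ?_ ?_
    · change bind₁ f.coord (X 0) = bind₁ φ.coord (C c * X 2 + (C c * bind₁ v p + q))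
      simp only [map_add, map_mul, bind₁_C_right, bind₁_X_right, h0, fix _ _ hps hφ0 hφ1,
        fix _ _ hq hφ0 hφ1, hφ2]
      ring
    · change bind₁ f.coord (X 1) = bind₁ φ.coord (C a * X 0 + C e)
      simp only [map_add, map_mul, bind₁_C_right, bind₁_X_right, h1, hφ0]
    · change bind₁ f.coord (X 2 - bind₁ v p) = bind₁ φ.coord (C b * X 1 + C 0)
      simp only [map_sub, map_mul, bind₁_C_right, bind₁_X_right, h2, hvp, hφ1, C_0,
        add_zero, add_sub_cancel_right]

/-- Conjugation by `(b y + p(x), x, z)`. -/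
theorem isNatQuadratic_of_cycle' (hf : IsUnit f) (hp : p ∈ supported k {0})
    (hq : q ∈ supported k {0, 1}) (hb : b ≠ 0) (h0 : f.coord 0 = C b * X 1 + p)
    (h1 : f.coord 1 = C c * X 2 + q) (h2 : f.coord 2 = C a * X 0 + C e) :
    IsNatQuadratic f.dynamicalDegree := by
  -- The first coordinate of `φ` is that of `f` and its second is x, so the conjugated map has
  -- second coordinate x and the shift case applies.
  let φ : PolyEnd k 3 := ⟨![C b * X 1 + p, X 0, X 2]⟩
  let py := bind₁ (![X 1, X 1, X 2] : Fin 3 → MvPolynomial (Fin 3) k) p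
  let ψ : PolyEnd k 3 := ⟨![X 1, C b⁻¹ * (X 0 - py), X 2]⟩
  have hpy : py ∈ supported k {1} := bind₁_mem_supported hp fun i hi => by
    rw [Set.mem_singleton_iff.mp hi]
    exact X_mem_supported.mpr (Set.mem_singleton 1)
  have hpy' : py ∈ supported k {0, 1} := supported_mono (by simp) hpy
  have hsub : ∀ w : Fin 3 → MvPolynomial (Fin 3) k, w 1 = X 0 → bind₁ w py = p := by
    intro w hw
    rw [bind₁_bind₁]
    refine bind₁_eq_self_of_mem_supported hp fun i hi => ?_
    rw [Set.mem_singleton_iff.mp hi]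
    exact (bind₁_X_right _ _).trans hw
  have hψp : bind₁ ψ.coord p = py := algHom_eq_of_mem_supported hp fun i hi => by
    rw [Set.mem_singleton_iff.mp hi, bind₁_X_right, bind₁_X_right]
    rfl
  have hψq : bind₁ ψ.coord q ∈ supported k {0, 1} := bind₁_mem_supported hq fun i hi => by
    rcases hi with rfl | hi
    · exact X_mem_supported.mpr (by simp)
    · rw [Set.mem_singleton_iff.mp hi]
      exact mul_mem (C_mem_supported _) (sub_mem (X_mem_supported.mpr (by simp)) hpy')
  have hφψ : φ * ψ = 1 := by
    refine ext_three ?_ (bind₁_X_right _ _) (bind₁_X_right _ _)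
    change bind₁ ψ.coord (C b * X 1 + p) = X 0
    rw [map_add, map_mul, bind₁_C_right, bind₁_X_right, hψp]
    change C b * (C b⁻¹ * (X 0 - py)) + py = X 0
    rw [C_mul_C_inv_mul hb, sub_add_cancel]
  have hψφ : ψ * φ = 1 := by
    refine ext_three (bind₁_X_right _ _) ?_ (bind₁_X_right _ _)
    change bind₁ φ.coord (C b⁻¹ * (X 0 - py)) = X 1
    rw [map_mul, map_sub, bind₁_C_right, bind₁_X_right, hsub _ rfl]
    change C b⁻¹ * (C b * X 1 + p - p) = X 1
    rw [add_sub_cancel_right, C_inv_mul_C_mul hb]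
  let f' : PolyEnd k 3 := ⟨![C (b * c) * X 2 + (C b * bind₁ ψ.coord q + p), C 1 * X 0 + C 0,
    C a * X 1 + C e]⟩
  refine isNatQuadratic_of_semiconj (f' := f') hf hφψ hψφ ?_ fun hu =>
    isNatQuadratic_of_shift hu
      (add_mem (mul_mem (C_mem_supported b) hψq) (supported_zero_le hp)) one_ne_zero rfl rfl rfl
  have hφ0 : φ.coord 0 = C b * X 1 + p := rfl
  have hφ1 : φ.coord 1 = X 0 := rfl
  have hφ2 : φ.coord 2 = X 2 := rfl
  have hpf : bind₁ f.coord p = bind₁ φ.coord p := algHom_eq_of_mem_supported hp fun i hi => by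
    rw [Set.mem_singleton_iff.mp hi, bind₁_X_right, bind₁_X_right, h0, hφ0]
  refine ext_three ?_ ?_ ?_
  · change bind₁ f.coord (C b * X 1 + p) =
      bind₁ φ.coord (C (b * c) * X 2 + (C b * bind₁ ψ.coord q + p))
    simp only [map_add, map_mul, bind₁_C_right, bind₁_X_right, h1, hφ2, hpf,
      bind₁_of_mul_eq_one hψφ]
    ring
  · change bind₁ f.coord (X 0) = bind₁ φ.coord (C 1 * X 0 + C 0)
    simp only [bind₁_X_right, h0, hφ0, C_1, C_0, one_mul, add_zero]
  · change bind₁ f.coord (X 2) = bind₁ φ.coord (C a * X 1 + C e)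
    simp only [map_add, map_mul, bind₁_C_right, bind₁_X_right, h2, hφ1]

/-- Conjugation by `(y, x, z)`. -/
theorem isNatQuadratic_of_fibered' (hf : IsUnit f) (hp : p ∈ supported k {0})
    (hq : q ∈ supported k {0, 1}) (ha : a ≠ 0) (h0 : f.coord 0 = C a * X 0 + C e)
    (h1 : f.coord 1 = C c * X 2 + q) (h2 : f.coord 2 = C b * X 1 + p) :
    IsNatQuadratic f.dynamicalDegree := by
  let φ : PolyEnd k 3 := ⟨![X 1, X 0, X 2]⟩
  have hφφ : φ * φ = 1 :=
    ext_three (bind₁_X_right _ _) (bind₁_X_right _ _) (bind₁_X_right _ _)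
  have hφp : bind₁ φ.coord p ∈ supported k {1} := bind₁_mem_supported hp fun i hi => by
    rw [Set.mem_singleton_iff.mp hi]
    exact X_mem_supported.mpr (Set.mem_singleton 1)
  have hφq : bind₁ φ.coord q ∈ supported k {0, 1} := bind₁_mem_supported hq fun i hi => by
    rcases hi with rfl | hi
    · exact X_mem_supported.mpr (by simp)
    · rw [Set.mem_singleton_iff.mp hi]
      exact X_mem_supported.mpr (by simp)
  let f' : PolyEnd k 3 := ⟨![C c * X 2 + bind₁ φ.coord q, C a * X 1 + C e,
    C b * X 0 + bind₁ φ.coord p]⟩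
  refine isNatQuadratic_of_semiconj (f' := f') hf hφφ hφφ ?_ fun hu =>
    isNatQuadratic_of_fibered hu hφp hφq ha rfl rfl rfl
  have hφ0 : φ.coord 0 = X 1 := rfl
  have hφ1 : φ.coord 1 = X 0 := rfl
  have hφ2 : φ.coord 2 = X 2 := rfl
  refine ext_three ?_ ?_ ?_
  · change bind₁ f.coord (X 1) = bind₁ φ.coord (C c * X 2 + bind₁ φ.coord q)
    simp only [map_add, map_mul, bind₁_C_right, bind₁_X_right, h1, hφ2, bind₁_of_mul_eq_one hφφ]
  · change bind₁ f.coord (X 0) = bind₁ φ.coord (C a * X 1 + C e)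
    simp only [map_add, map_mul, bind₁_C_right, bind₁_X_right, h0, hφ1]
  · change bind₁ f.coord (X 2) = bind₁ φ.coord (C b * X 0 + bind₁ φ.coord p)
    simp only [map_add, map_mul, bind₁_C_right, bind₁_X_right, h2, hφ0, bind₁_of_mul_eq_one hφφ]

theorem perm_three_cases : ∀ e : Equiv.Perm (Fin 3),
    (e 0 = 0 ∧ e 1 = 1 ∧ e 2 = 2) ∨ (e 0 = 1 ∧ e 1 = 0 ∧ e 2 = 2) ∨
    (e 0 = 0 ∧ e 1 = 2 ∧ e 2 = 1) ∨ (e 0 = 2 ∧ e 1 = 1 ∧ e 2 = 0) ∨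
    (e 0 = 1 ∧ e 1 = 2 ∧ e 2 = 0) ∨ (e 0 = 2 ∧ e 1 = 0 ∧ e 2 = 1) := by
  decide

theorem IsTriangular.coord_three {τ : PolyEnd k 3} (hτ : τ.IsTriangular) (hu : IsUnit τ) :
    ∃ (a b c e : k) (p q : MvPolynomial (Fin 3) k), a ≠ 0 ∧ b ≠ 0 ∧ p ∈ supported k {0} ∧
      q ∈ supported k {0, 1} ∧ τ.coord 0 = C a * X 0 + C e ∧ τ.coord 1 = C b * X 1 + p ∧
      τ.coord 2 = C c * X 2 + q := by
  obtain ⟨a, ha, r, hr, h0⟩ := hτ.exists_coord_eq hu 0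
  obtain ⟨b, hb, p, hp, h1⟩ := hτ.exists_coord_eq hu 1
  obtain ⟨c, -, q, hq, h2⟩ := hτ.exists_coord_eq hu 2
  have e0 : Set.Iio (0 : Fin 3) = ∅ := by ext i; fin_cases i <;> simp
  have e1 : Set.Iio (1 : Fin 3) = {0} := by ext i; fin_cases i <;> simp
  have e2 : Set.Iio (2 : Fin 3) = {0, 1} := by ext i; fin_cases i <;> simp
  rw [e0, supported_empty, Algebra.mem_bot] at hr
  obtain ⟨e, rfl⟩ := hr
  rw [e1] at hp
  rw [e2] at hq
  exact ⟨a, b, c, e, p, q, ha, hb, hp, hq, h0, h1, h2⟩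

theorem IsAffineTriangular.isNatQuadratic {g : PolyEnd k 3} (hg : IsUnit g)
    (h : g.IsAffineTriangular) : IsNatQuadratic g.dynamicalDegree := by
  obtain ⟨σ, τ, hτ, hτt, hc⟩ := h.exists_isConj_perm_mul hg
  rw [← dynamicalDegree_eq_of_isConj hc hg]
  have hu : IsUnit (perm k σ * τ) := (isUnit_perm σ).mul hτ
  obtain ⟨a, b, c, e, p, q, ha, hb, hp, hq, h0, h1, h2⟩ := hτt.coord_three hτ
  have hσ : ∀ i j : Fin 3, σ i = j → (perm k σ * τ).coord i = τ.coord j := by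
    rintro i j rfl
    exact perm_mul_coord σ τ i
  rcases perm_three_cases σ with ⟨s0, s1, s2⟩ | ⟨s0, s1, s2⟩ | ⟨s0, s1, s2⟩ | ⟨s0, s1, s2⟩ |
    ⟨s0, s1, s2⟩ | ⟨s0, s1, s2⟩
  · exact isNatQuadratic_of_triangular hu hp hq ((hσ _ _ s0).trans h0) ((hσ _ _ s1).trans h1)
      ((hσ _ _ s2).trans h2)
  · exact isNatQuadratic_of_henon hu hp hq ha ((hσ _ _ s0).trans h1) ((hσ _ _ s1).trans h0)
      ((hσ _ _ s2).trans h2)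
  · exact isNatQuadratic_of_fibered' hu hp hq ha ((hσ _ _ s0).trans h0) ((hσ _ _ s1).trans h2)
      ((hσ _ _ s2).trans h1)
  · exact isNatQuadratic_of_reversal hu hp hq hb ((hσ _ _ s0).trans h2) ((hσ _ _ s1).trans h1)
      ((hσ _ _ s2).trans h0)
  · exact isNatQuadratic_of_cycle' hu hp hq hb ((hσ _ _ s0).trans h1) ((hσ _ _ s1).trans h2)
      ((hσ _ _ s2).trans h0)
  · exact isNatQuadratic_of_cycle hu hp hq ha ((hσ _ _ s0).trans h2) ((hσ _ _ s1).trans h0)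
      ((hσ _ _ s2).trans h1)

end PolyEnd

theorem mainTheorem10 (k : Type*) [Field k] (r s t : ℕ)
    (hr : 1 ≤ r) (hs : 1 ≤ s) (ht : 1 ≤ t) :
    IsUnit (PolyEnd.rstMap k r s t) ∧
    Tendsto (PolyEnd.rstMap k r s t).degreeSeq atTop
      (𝓝 (PolyEnd.rstMap k r s t).dynamicalDegree) ∧
    IsGreatest {x : ℝ | x ^ 2 - ((r : ℝ) + s + t) * x + (r : ℝ) * s = 0}
      (PolyEnd.rstMap k r s t).dynamicalDegree ∧
    (s : ℝ) + 1 < (PolyEnd.rstMap k r s t).dynamicalDegree ∧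
    ((∀ m : ℤ, (PolyEnd.rstMap k r s t).dynamicalDegree ≠ (m : ℝ)) →
      (∀ g : PolyEnd k 3, IsUnit g → g.IsAffineTriangular →
        g.dynamicalDegree ≠ (PolyEnd.rstMap k r s t).dynamicalDegree) ∧
      ¬ ∃ g : PolyEnd k 3, IsUnit g ∧ g.IsAffineTriangular ∧
        IsConj (PolyEnd.rstMap k r s t) g) := by
  have hu := PolyEnd.isUnit_rstMap (k := k) r s t
  have hdeg := PolyEnd.dynamicalDegree_rstMap (k := k) (s := s) hr ht
  have hgreatest := isGreatest_rstRoot (s := s) hr ht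
  refine ⟨hu, PolyEnd.tendsto_degreeSeq hu, ?_, ?_, fun hint => ?_⟩
  · rw [hdeg]
    exact hgreatest
  · rw [hdeg]
    exact lt_rstRoot hr ht
  have hne : ∀ g : PolyEnd k 3, IsUnit g → g.IsAffineTriangular →
      g.dynamicalDegree ≠ (PolyEnd.rstMap k r s t).dynamicalDegree := by
    intro g hg hgt
    obtain ⟨a, b, hab⟩ := hgt.isNatQuadratic hg
    refine ne_of_sq_eq_nat_mul_add (B := r + s + t) hr hs ?_ hint hab
    rw [hdeg]
    push_cast
    exact hgreatest.1
  refine ⟨hne, ?_⟩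
  rintro ⟨g, hg, hgt, hc⟩
  exact hne g hg hgt (PolyEnd.dynamicalDegree_eq_of_isConj hc hu)
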